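/- For $\phi\in L^2(\mathbb R)$ (complex-valued) let $$V_2(\phi)=\Big\{\sum_{k\in\mathbb Z}c(k)\,\phi(\cdot-k)\ :\ c=(c(k))_{k\in\mathbb Z}\in\ell^2(\mathbb Z)\Big\}\subset L^2(\mathbb R),$$ the series converging (unconditionally) in $L^2(\mathbb R)$, and let $\widehat\phi(\xi)=\int_{\mathbb R}\phi(x)e^{-2\pi i x\xi}\,dx$ for $\phi\in L^1(\mathbb R)$. A subspace $V\subset L^2(\mathbb R)$ is called $\frac1n\mathbb Z$-invariant if $f(\cdot-\frac mn)\in V$ for all $f\in V$ and all $m\in\mathbb Z$. **Theorem.** For each integer $n\ge 2$ there exists a function $\phi\in L^1(\mathbb R)\cap L^2(\mathbb R)$, depending only on $n$ (and hence $\widehat\phi$ is continuous), such that $\{\phi(\cdot-k) : k\in\mathbb Z\}$ is an orthonormal basis of $V_2(\phi)$, the space $V_2(\phi)$ is $\frac1n\mathbb Z$-invariant, $$\int_{\mathbb R}|\phi(x)|^2(1+|x|)^{1-\epsilon}\,dx<\infty\quad\text{for every }\epsilon>0,\qquad\text{and}\qquad \sup_{\xi\in\mathbb R}|\widehat\phi(\xi)|\,|\xi|^{1/2}<\infty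 .$$ -/

import Mathlib

open MeasureTheory
open scoped FourierTransform ENNReal

noncomputable section

/-- The Hilbert space `L² = L²(ℝ)` of square-integrable complex-valued functions on the real
line. -/
abbrev L2R : Type := Lp ℂ 2 (volume : Measure ℝ)

/-- The translate `f(· - t)` of `f ∈ L²(ℝ)`. -/
def translateL2 (t : ℝ) (f : L2R) : L2R :=
  Lp.compMeasurePreserving (fun x : ℝ => x - t) (measurePreserving_sub_right volume t) f

/-- The translate is represented by the function `x ↦ f (x - t)`. -/
theorem coeFn_translate (t : ℝ) (f : L2R) :
    (translateL2 t f : ℝ → ℂ) =ᵐ[volume] fun x => f (x - t) :=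
  Lp.coeFn_compMeasurePreserving f (measurePreserving_sub_right volume t)

/-- The space `V₂(φ)` of all sums `∑_{k ∈ ℤ} c(k) φ(· - k)` with `c ∈ ℓ²(ℤ)`, the series
converging (unconditionally) in `L²(ℝ)`. -/
def V2 (φ : L2R) : Submodule ℂ L2R where
  carrier := {f | ∃ c : lp (fun _ : ℤ => ℂ) 2, HasSum (fun k : ℤ => c k • translateL2 (k : ℝ) φ) f}
  zero_mem' := ⟨0, by simp⟩
  add_mem' := by
    rintro f g ⟨c, hc⟩ ⟨d, hd⟩
    exact ⟨c + d, by simpa [add_smul] using hc.add hd⟩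
  smul_mem' := by
    rintro a f ⟨c, hc⟩
    exact ⟨a • c, by simpa [mul_smul] using hc.const_smul a⟩

/-- The integer translates `φ(· - k)`, `k ∈ ℤ`, form an orthonormal basis (a complete orthonormal
system) of `V₂(φ)`. -/
def IsOrthonormalGenerator (φ : L2R) : Prop :=
  Orthonormal ℂ (fun k : ℤ => translateL2 (k : ℝ) φ) ∧
    (Submodule.span ℂ (Set.range fun k : ℤ => translateL2 (k : ℝ) φ)).topologicalClosure = V2 φ

/-- `τ(V)`, the set of all `t ∈ ℝ` such that `f(· - t) ∈ V` for all `f ∈ V`. -/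
def invarianceSet (V : Submodule ℂ L2R) : Set ℝ :=
  {t | ∀ f ∈ V, translateL2 t f ∈ V}

/-- `V` is `(1/n)ℤ`-invariant: it is invariant under all translations by `m / n`, `m ∈ ℤ`. -/
def IsFracInvariant (n : ℕ) (V : Submodule ℂ L2R) : Prop :=
  ∀ m : ℤ, (m : ℝ) / (n : ℝ) ∈ invarianceSet V

end

/-! Put $P_L(t)=\sin(\pi t)e^{L\cos^2(\pi t)/2}$ on $[0,1]$ and let $\phi(x)$ be the Fourier
integral of $P_L$ at $x$, with $L=-\log\{nx\}$. The parameter is constant on each coset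
$x\in(Y+\mathbb Z)/n$. There the values of $\phi$ are, up to the factor $n$, the Fourier
coefficients on a circle of length $n$ of one modulated profile supported in $[0,1]$.

Orthogonality and invariance: Parseval on each coset, followed by integration in $Y$, gives
$\langle\phi(\cdot-m/n),\phi\rangle=\int_0^1\big(\int_0^1P_{-\log Y}(t)^2dY\big)e^{2\pi imt/n}dt$.
Since $P_{-\log Y}(t)^2=\sin^2(\pi t)\,Y^{\sin^2(\pi t)-1}$, the inner integral is $1$ for $0<t<1$.
So the translates by $\frac1n\mathbb Z$ have the Gram matrix of the exponentials $e^{2\pi imt/n}$ in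
$L^2[0,1]$. Integer translates are orthonormal, and every $\phi(\cdot-m/n)$ attains equality in
Bessel's inequality, hence lies in their closed span (`integral_generator_sub_mul_conj`,
`translateL2_div_generator_mem`).

Localization: the transform of $P_L$ is $O(e^{L/2}/(1+L))$ and $O(e^{L/2}/(1+|x|)^2)$.
Interpolating, $|\phi|^2$ is controlled by $y^{-1}(1-\log y)^{-s}$, $y=\{nx\}$, which is integrable
for $s>1$, times a power of $1+|x|$ (`norm_sq_profileTransform_le`).

Fourier decay: summing the Fourier series on each coset shows that $\widehat\phi(-(\theta+nk))$ is,
for $\theta\in[0,1]$, $\sin(\pi\theta)$ times a Fourier coefficient of $Y^{-\alpha}$ with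
$\alpha=\cos^2(\pi\theta)/2\le\frac12$, and vanishes for other $\theta\in[0,n)$. Such coefficients
are $O(|k|^{-1/2})$ (`fourier_generator_eq`, `norm_integral_rpow_mul_exp_le`). -/

noncomputable section

/-! ### Bounds for the profile and its Fourier integral -/

open Real in
/-- The profile `sin (πt) exp (L cos² (πt) / 2)` on the unit interval. -/
def profile (L t : ℝ) : ℝ := sin (π * t) * exp (L * cos (π * t) ^ 2 / 2)

/-- The Fourier integral over the unit interval of the profile with parameter `L`. -/
def profileTransform (L x : ℝ) : ℂ :=
  ∫ t in (0 : ℝ)..1, (profile L t : ℂ) * Complex.exp (-(2 * Real.pi * x * t : ℝ) * Complex.I)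

theorem continuous_profile (L : ℝ) : Continuous (profile L) := by
  unfold profile; fun_prop

theorem profile_zero (L : ℝ) : profile L 0 = 0 := by simp [profile]

theorem profile_one (L : ℝ) : profile L 1 = 0 := by simp [profile]

theorem profile_nonneg (L : ℝ) {t : ℝ} (h0 : 0 ≤ t) (h1 : t ≤ 1) : 0 ≤ profile L t :=
  mul_nonneg (Real.sin_nonneg_of_nonneg_of_le_pi (by positivity)
    (by nlinarith [Real.pi_pos])) (Real.exp_pos _).le

/-- Since $c^2\le|c|$ for $c=\cos(\pi t)$, the exponential is at most $2\cosh((1+L)c/2)$, which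
times $\sin(\pi t)$ has an explicit primitive. Using $1+L$ instead of $L$ keeps that primitive
meaningful at $L=0$. -/
theorem integral_profile_le {L : ℝ} (hL : 0 ≤ L) :
    ∫ t in (0 : ℝ)..1, profile L t ≤ 4 * (Real.exp (L / 2) / (1 + L)) := by
  have hpi := Real.pi_gt_three
  set F : ℝ → ℝ := fun t =>
    -(4 / (Real.pi * (1 + L))) * Real.sinh ((1 + L) * Real.cos (Real.pi * t) / 2)
  set f : ℝ → ℝ := fun t =>
    Real.sin (Real.pi * t) * (2 * Real.cosh ((1 + L) * Real.cos (Real.pi * t) / 2))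
  have hF : ∀ t ∈ Set.uIcc (0 : ℝ) 1, HasDerivAt F (f t) t := by
    intro t _
    have h1 : HasDerivAt (fun t : ℝ => Real.pi * t) Real.pi t := by
      simpa using (hasDerivAt_id t).const_mul Real.pi
    have h2 := (((h1.cos.const_mul (1 + L)).div_const 2).sinh).const_mul
      (-(4 / (Real.pi * (1 + L))))
    refine h2.congr_deriv ?_
    simp only [f]
    field_simp
    ring
  have hf : Continuous f := by
    have := Real.continuous_cosh
    simp only [f]; fun_prop
  have hint : ∫ t in (0 : ℝ)..1, f t = F 1 - F 0 :=
    intervalIntegral.integral_eq_sub_of_hasDerivAt hF (hf.intervalIntegrable _ _)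
  have hle : ∫ t in (0 : ℝ)..1, profile L t ≤ ∫ t in (0 : ℝ)..1, f t := by
    apply intervalIntegral.integral_mono_on zero_le_one
      ((continuous_profile L).intervalIntegrable _ _) (hf.intervalIntegrable _ _)
    intro t ht
    have hs : 0 ≤ Real.sin (Real.pi * t) :=
      Real.sin_nonneg_of_nonneg_of_le_pi (by have := ht.1; positivity)
        (by nlinarith [ht.2])
    refine mul_le_mul_of_nonneg_left ?_ hs
    set c := Real.cos (Real.pi * t)
    have hc1 := Real.cos_le_one (Real.pi * t)
    have hc2 := Real.neg_one_le_cos (Real.pi * t)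
    rw [Real.cosh_eq]
    have e1 := Real.exp_pos ((1 + L) * c / 2)
    have e2 := Real.exp_pos (-((1 + L) * c / 2))
    rcases le_total 0 c with h | h
    · have : Real.exp (L * c ^ 2 / 2) ≤ Real.exp ((1 + L) * c / 2) := by
        apply Real.exp_le_exp.2
        have : L * c ^ 2 ≤ L * c := mul_le_mul_of_nonneg_left (by nlinarith) hL
        linarith
      linarith
    · have : Real.exp (L * c ^ 2 / 2) ≤ Real.exp (-((1 + L) * c / 2)) := by
        apply Real.exp_le_exp.2
        have : L * c ^ 2 ≤ L * (-c) := mul_le_mul_of_nonneg_left (by nlinarith) hL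
        linarith
      linarith
  refine hle.trans ?_
  rw [hint]
  simp only [F, mul_one, mul_zero, Real.cos_pi, Real.cos_zero, mul_neg, neg_div, Real.sinh_neg]
  have h3 : Real.sinh ((1 + L) / 2) ≤ Real.exp (L / 2) := by
    rw [Real.sinh_eq]
    have : Real.exp ((1 + L) / 2) = Real.exp (L / 2) * Real.exp (1 / 2) := by
      rw [← Real.exp_add]; ring_nf
    rw [this]
    have h4 : Real.exp (1 / 2) ≤ 2 := by
      have := Real.exp_one_lt_d9
      have h5 : Real.exp (1 / 2) * Real.exp (1 / 2) = Real.exp 1 := by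
        rw [← Real.exp_add]; norm_num
      nlinarith [Real.exp_pos (1 / 2)]
    nlinarith [Real.exp_pos (L / 2), Real.exp_pos (-((1 + L) / 2))]
  have h6 : 8 / (Real.pi * (1 + L)) ≤ 4 / (1 + L) := by
    rw [div_le_div_iff₀ (by positivity) (by positivity)]
    nlinarith
  calc _ = 8 / (Real.pi * (1 + L)) * Real.sinh ((1 + L) / 2) := by ring
    _ ≤ 8 / (Real.pi * (1 + L)) * Real.exp (L / 2) := by gcongr
    _ ≤ 4 / (1 + L) * Real.exp (L / 2) := by gcongr
    _ = _ := by ring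

open Real in
/-- The derivative of the profile. -/
def profileDeriv (L t : ℝ) : ℝ :=
  π * (cos (π * t) * (1 - L * sin (π * t) ^ 2) * exp (L * cos (π * t) ^ 2 / 2))

open Real in
/-- The second derivative of the profile. -/
def profileDeriv₂ (L t : ℝ) : ℝ :=
  π ^ 2 * (profile L t * (-(1 - L * sin (π * t) ^ 2) - 3 * L * cos (π * t) ^ 2
    + L ^ 2 * sin (π * t) ^ 2 * cos (π * t) ^ 2))

theorem hasDerivAt_exp_cos_sq (L t : ℝ) :
    HasDerivAt (fun t => Real.exp (L * Real.cos (Real.pi * t) ^ 2 / 2))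
      (-(Real.pi * L * Real.sin (Real.pi * t) * Real.cos (Real.pi * t))
        * Real.exp (L * Real.cos (Real.pi * t) ^ 2 / 2)) t := by
  have h1 : HasDerivAt (fun t : ℝ => Real.pi * t) Real.pi t := by
    simpa using (hasDerivAt_id t).const_mul Real.pi
  refine (((h1.cos.pow 2).const_mul L).div_const 2).exp.congr_deriv ?_
  simp only [Nat.cast_ofNat, Nat.add_one_sub_one, pow_one, Pi.pow_apply]
  ring

theorem hasDerivAt_profile (L t : ℝ) : HasDerivAt (profile L) (profileDeriv L t) t := by
  have h1 : HasDerivAt (fun t : ℝ => Real.pi * t) Real.pi t := by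
    simpa using (hasDerivAt_id t).const_mul Real.pi
  refine (h1.sin.mul (hasDerivAt_exp_cos_sq L t)).congr_deriv ?_
  simp only [profileDeriv]
  ring

theorem hasDerivAt_profileDeriv (L t : ℝ) :
    HasDerivAt (profileDeriv L) (profileDeriv₂ L t) t := by
  have h1 : HasDerivAt (fun t : ℝ => Real.pi * t) Real.pi t := by
    simpa using (hasDerivAt_id t).const_mul Real.pi
  refine (((h1.cos.mul (((h1.sin.pow 2).const_mul L).const_sub 1)).mul
    (hasDerivAt_exp_cos_sq L t)).const_mul Real.pi).congr_deriv ?_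
  simp only [profileDeriv₂, profile, Nat.cast_ofNat, Nat.add_one_sub_one, pow_one, Pi.pow_apply,
    Pi.mul_apply]
  ring

theorem continuous_profileDeriv₂ (L : ℝ) : Continuous (profileDeriv₂ L) := by
  unfold profileDeriv₂ profile; fun_prop

/-- The dangerous term is $L^2\int P_L s^2c^2$, where $s=\sin(\pi t)$ and $c=\cos(\pi t)$. As
$s^2c\,e^{Lc^2/2}$ vanishes at both ends, integrating its derivative gives $L\int P_Ls^2c^2=\int
P_L(2c^2-s^2)\le2\int P_L$. One power of $L$ is thus saved, and `integral_profile_le` absorbs the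
other. -/
theorem integral_abs_profileDeriv₂_le {L : ℝ} (hL : 0 ≤ L) :
    ∫ t in (0 : ℝ)..1, |profileDeriv₂ L t| ≤ 20 * Real.pi ^ 2 * Real.exp (L / 2) := by
  set s : ℝ → ℝ := fun t => Real.sin (Real.pi * t)
  set c : ℝ → ℝ := fun t => Real.cos (Real.pi * t)
  have hs : Continuous s := by simp only [s]; fun_prop
  have hc : Continuous c := by simp only [c]; fun_prop
  have hW := continuous_profile L
  set F : ℝ → ℝ := fun t => s t ^ 2 * c t * Real.exp (L * c t ^ 2 / 2)
  set f : ℝ → ℝ := fun t => Real.pi * (profile L t * (2 * c t ^ 2 - s t ^ 2))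
    - Real.pi * L * (profile L t * (s t ^ 2 * c t ^ 2))
  have hF : ∀ t ∈ Set.uIcc (0 : ℝ) 1, HasDerivAt F (f t) t := by
    intro t _
    have h1 : HasDerivAt (fun t : ℝ => Real.pi * t) Real.pi t := by
      simpa using (hasDerivAt_id t).const_mul Real.pi
    refine (((h1.sin.pow 2).mul h1.cos).mul (hasDerivAt_exp_cos_sq L t)).congr_deriv ?_
    simp only [f, profile, s, c, Nat.cast_ofNat, Nat.add_one_sub_one, pow_one, Pi.mul_apply, Pi.pow_apply]
    ring
  have hi1 : Continuous fun t => profile L t * (2 * c t ^ 2 - s t ^ 2) := by fun_prop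
  have hi2 : Continuous fun t => profile L t * (s t ^ 2 * c t ^ 2) := by fun_prop
  have hf : Continuous f := by simp only [f]; fun_prop
  have hint : ∫ t in (0 : ℝ)..1, f t = F 1 - F 0 :=
    intervalIntegral.integral_eq_sub_of_hasDerivAt hF (hf.intervalIntegrable _ _)
  have hF0 : F 1 - F 0 = 0 := by simp [F, s]
  have heq : L * ∫ t in (0 : ℝ)..1, profile L t * (s t ^ 2 * c t ^ 2) =
      ∫ t in (0 : ℝ)..1, profile L t * (2 * c t ^ 2 - s t ^ 2) := by
    rw [hF0] at hint
    simp only [f] at hint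
    rw [intervalIntegral.integral_sub
      ((hi1.const_mul _).intervalIntegrable _ _) ((hi2.const_mul _).intervalIntegrable _ _),
      intervalIntegral.integral_const_mul, intervalIntegral.integral_const_mul, mul_assoc,
      ← mul_sub] at hint
    have := (mul_eq_zero.1 hint).resolve_left Real.pi_pos.ne'
    linarith
  have hsc : ∀ t, s t ^ 2 + c t ^ 2 = 1 := fun t => Real.sin_sq_add_cos_sq _
  have hle1 : ∫ t in (0 : ℝ)..1, profile L t * (2 * c t ^ 2 - s t ^ 2) ≤
      ∫ t in (0 : ℝ)..1, 2 * profile L t := by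
    apply intervalIntegral.integral_mono_on zero_le_one (hi1.intervalIntegrable _ _)
      ((hW.const_mul 2).intervalIntegrable _ _)
    intro t ht
    nlinarith [profile_nonneg L ht.1 ht.2, hsc t, sq_nonneg (s t)]
  rw [intervalIntegral.integral_const_mul] at hle1
  have hle2 : ∫ t in (0 : ℝ)..1, |profileDeriv₂ L t| ≤
      ∫ t in (0 : ℝ)..1, Real.pi ^ 2 * ((1 + 3 * L) * profile L t +
        L ^ 2 * (profile L t * (s t ^ 2 * c t ^ 2))) := by
    apply intervalIntegral.integral_mono_on zero_le_one
      ((continuous_profileDeriv₂ L).abs.intervalIntegrable _ _)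
      ((by fun_prop : Continuous _).intervalIntegrable _ _)
    intro t ht
    have hp := profile_nonneg L ht.1 ht.2
    rw [profileDeriv₂, abs_mul, abs_of_nonneg (by positivity : (0 : ℝ) ≤ Real.pi ^ 2), abs_mul,
      abs_of_nonneg hp]
    refine mul_le_mul_of_nonneg_left ?_ (by positivity)
    have : |-(1 - L * Real.sin (Real.pi * t) ^ 2) - 3 * L * Real.cos (Real.pi * t) ^ 2
        + L ^ 2 * Real.sin (Real.pi * t) ^ 2 * Real.cos (Real.pi * t) ^ 2| ≤
        1 + 3 * L + L ^ 2 * (s t ^ 2 * c t ^ 2) := by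
      change |-(1 - L * s t ^ 2) - 3 * L * c t ^ 2 + L ^ 2 * s t ^ 2 * c t ^ 2| ≤ _
      have h1 := mul_nonneg hL (sq_nonneg (s t))
      have h2 := mul_nonneg hL (sq_nonneg (c t))
      have h3 : L * s t ^ 2 + L * c t ^ 2 = L := by rw [← mul_add, hsc, mul_one]
      have h4 : 0 ≤ L ^ 2 * s t ^ 2 * c t ^ 2 := by positivity
      rw [abs_le]
      constructor <;> nlinarith
    calc _ ≤ profile L t * (1 + 3 * L + L ^ 2 * (s t ^ 2 * c t ^ 2)) :=
          mul_le_mul_of_nonneg_left this hp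
      _ = _ := by ring
  refine hle2.trans ?_
  rw [intervalIntegral.integral_const_mul, intervalIntegral.integral_add
    ((hW.const_mul _).intervalIntegrable _ _) ((hi2.const_mul _).intervalIntegrable _ _),
    intervalIntegral.integral_const_mul, intervalIntegral.integral_const_mul, sq L, mul_assoc L,
    heq, mul_assoc 20, mul_left_comm 20]
  refine mul_le_mul_of_nonneg_left ?_ (by positivity)
  have hI := integral_profile_le hL
  have hI0 : 0 ≤ ∫ t in (0 : ℝ)..1, profile L t :=
    intervalIntegral.integral_nonneg zero_le_one fun t ht => profile_nonneg L ht.1 ht.2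
  set I := ∫ t in (0 : ℝ)..1, profile L t
  rw [← mul_div_assoc, le_div_iff₀ (by positivity)] at hI
  nlinarith [mul_le_mul_of_nonneg_left hle1 hL]

theorem norm_profileTransform_le {L : ℝ} (hL : 0 ≤ L) (x : ℝ) :
    ‖profileTransform L x‖ ≤ 4 * (Real.exp (L / 2) / (1 + L)) := by
  refine le_trans ?_ (integral_profile_le hL)
  refine (intervalIntegral.norm_integral_le_integral_norm zero_le_one).trans (le_of_eq ?_)
  refine intervalIntegral.integral_congr fun t ht => ?_
  rw [Set.uIcc_of_le zero_le_one] at ht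
  simp only [norm_mul]
  rw [← Complex.ofReal_neg, Complex.norm_exp_ofReal_mul_I, mul_one, Complex.norm_real,
    Real.norm_of_nonneg (profile_nonneg L ht.1 ht.2)]

/-- Two integrations by parts. The profile vanishes at the endpoints, so only the boundary values of
its derivative, of modulus $\pi e^{L/2}$, and the integral of its second derivative remain. -/
theorem sq_mul_norm_profileTransform_le {L : ℝ} (hL : 0 ≤ L) (x : ℝ) :
    x ^ 2 * ‖profileTransform L x‖ ≤ 6 * Real.exp (L / 2) := by
  set a : ℝ := 2 * Real.pi * x
  set e : ℝ → ℂ := fun t => Complex.exp (-(a * t : ℝ) * Complex.I)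
  have hne : ∀ t, ‖e t‖ = 1 := fun t => by
    simp only [e]
    rw [← Complex.ofReal_neg, Complex.norm_exp_ofReal_mul_I]
  have hec : Continuous e := by simp only [e]; fun_prop
  have he : ∀ t, HasDerivAt e (e t * (-a * Complex.I)) t := fun t => by
    have h1 : HasDerivAt (fun t : ℝ => (-(a * t : ℝ) * Complex.I : ℂ)) (-a * Complex.I) t := by
      have := (((hasDerivAt_id t).const_mul a).ofReal_comp.neg).mul_const Complex.I
      simpa using this
    exact h1.cexp
  have hc1 := (continuous_profile L)
  have hc2 := (continuous_profileDeriv₂ L)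
  have hG : ∀ t ∈ Set.uIcc (0 : ℝ) 1,
      HasDerivAt (fun t => (profileDeriv L t : ℂ) * e t -
        (profile L t : ℂ) * (e t * (-a * Complex.I)))
        ((profileDeriv₂ L t : ℂ) * e t + (a : ℂ) ^ 2 * ((profile L t : ℂ) * e t)) t := by
    intro t _
    refine (((hasDerivAt_profileDeriv L t).ofReal_comp.mul (he t)).sub
      ((hasDerivAt_profile L t).ofReal_comp.mul
        ((he t).mul_const (-a * Complex.I)))).congr_deriv ?_
    linear_combination (-(a : ℂ) ^ 2 * profile L t * e t) * Complex.I_sq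
  have hd2 : Continuous fun t => (profileDeriv₂ L t : ℂ) * e t := by fun_prop
  have hd1 : Continuous fun t => (a : ℂ) ^ 2 * ((profile L t : ℂ) * e t) := by fun_prop
  have hint := intervalIntegral.integral_eq_sub_of_hasDerivAt hG
    ((hd2.add hd1).intervalIntegrable _ _)
  rw [intervalIntegral.integral_add (hd2.intervalIntegrable _ _) (hd1.intervalIntegrable _ _),
    intervalIntegral.integral_const_mul] at hint
  have hu : ∫ t in (0 : ℝ)..1, (profile L t : ℂ) * e t = profileTransform L x := rfl
  rw [hu, profile_zero, profile_one] at hint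
  simp only [Complex.ofReal_zero, zero_mul, sub_zero] at hint
  have hD : ∀ t ∈ ({0, 1} : Set ℝ), ‖(profileDeriv L t : ℂ) * e t‖ ≤ Real.pi * Real.exp (L / 2) := by
    intro t ht
    rw [norm_mul, hne, mul_one, Complex.norm_real, Real.norm_eq_abs]
    rcases ht with rfl | rfl
    · simp [profileDeriv, abs_of_pos Real.pi_pos]
    · simp [profileDeriv, abs_of_pos Real.pi_pos]
  have h2 : ‖∫ t in (0 : ℝ)..1, (profileDeriv₂ L t : ℂ) * e t‖ ≤
      20 * Real.pi ^ 2 * Real.exp (L / 2) := by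
    refine le_trans ?_ (integral_abs_profileDeriv₂_le hL)
    refine (intervalIntegral.norm_integral_le_integral_norm zero_le_one).trans (le_of_eq ?_)
    refine intervalIntegral.integral_congr fun t _ => ?_
    simp only [norm_mul, hne, mul_one, Complex.norm_real, Real.norm_eq_abs]
  have h3 : (a : ℂ) ^ 2 * profileTransform L x = (profileDeriv L 1 : ℂ) * e 1 -
      (profileDeriv L 0 : ℂ) * e 0 - ∫ t in (0 : ℝ)..1, (profileDeriv₂ L t : ℂ) * e t := by
    linear_combination hint
  have h4 : a ^ 2 * ‖profileTransform L x‖ ≤ Real.pi * Real.exp (L / 2) +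
      Real.pi * Real.exp (L / 2) + 20 * Real.pi ^ 2 * Real.exp (L / 2) := by
    have : ‖(a : ℂ) ^ 2 * profileTransform L x‖ = a ^ 2 * ‖profileTransform L x‖ := by
      rw [norm_mul, norm_pow, Complex.norm_real, Real.norm_eq_abs, sq_abs]
    rw [← this, h3]
    exact (norm_sub_le _ _).trans (add_le_add ((norm_sub_le _ _).trans
      (add_le_add (hD 1 (by simp)) (hD 0 (by simp)))) h2)
  have hpi := Real.pi_gt_three
  have h5 : (4 * Real.pi ^ 2) * (x ^ 2 * ‖profileTransform L x‖) ≤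
      (4 * Real.pi ^ 2) * (6 * Real.exp (L / 2)) := by
    have : a ^ 2 = 4 * Real.pi ^ 2 * x ^ 2 := by simp only [a]; ring
    rw [this] at h4
    have : 2 * Real.pi ≤ 4 * Real.pi ^ 2 := by nlinarith
    nlinarith [Real.exp_pos (L / 2)]
  exact le_of_mul_le_mul_left h5 (by positivity)

theorem norm_profileTransform_le_div_sq {L : ℝ} (hL : 0 ≤ L) (x : ℝ) :
    ‖profileTransform L x‖ ≤ 20 * (Real.exp (L / 2) * ((1 + |x|) ^ 2)⁻¹) := by
  have h1 := norm_profileTransform_le hL x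
  have h2 := sq_mul_norm_profileTransform_le hL x
  have h3 : Real.exp (L / 2) / (1 + L) ≤ Real.exp (L / 2) :=
    div_le_self (Real.exp_pos _).le (by linarith)
  rw [← mul_assoc, ← div_eq_mul_inv, le_div_iff₀ (by positivity)]
  have h4 : (1 + |x|) ^ 2 ≤ 2 * (1 + x ^ 2) := by
    nlinarith [sq_abs x, sq_nonneg (|x| - 1)]
  nlinarith [norm_nonneg (profileTransform L x)]

/-- Geometric interpolation of the two pointwise bounds with exponents $s$ and $2-s$. It trades
decay in $x$ for the logarithmic gain that makes $e^L=1/y$ integrable near $y=0$. -/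
theorem norm_sq_profileTransform_le {L : ℝ} (hL : 0 ≤ L) (x : ℝ) {s : ℝ} (h0 : 0 ≤ s)
    (h2 : s ≤ 2) :
    ‖profileTransform L x‖ ^ 2 ≤
      400 * Real.exp L * ((1 + L) ^ (-s) * (1 + |x|) ^ (-(2 * (2 - s)))) := by
  have hx : 0 < 1 + |x| := by positivity
  have hL' : 0 < 1 + L := by positivity
  have b1 : ‖profileTransform L x‖ ≤ 20 * Real.exp (L / 2) * (1 + L)⁻¹ := by
    have := norm_profileTransform_le hL x
    rw [div_eq_mul_inv] at this
    have h : 0 ≤ Real.exp (L / 2) * (1 + L)⁻¹ := by positivity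
    linarith
  have b2 : ‖profileTransform L x‖ ≤ 20 * Real.exp (L / 2) * ((1 + |x|) ^ 2)⁻¹ := by
    simpa [mul_assoc] using norm_profileTransform_le_div_sq hL x
  set A := 20 * Real.exp (L / 2) with hA
  have hA0 : 0 < A := by positivity
  have hA2 : A ^ (2 : ℝ) = 400 * Real.exp L := by
    rw [Real.rpow_two, hA, mul_pow, ← Real.exp_nat_mul]
    norm_num
    ring_nf
  have key : ‖profileTransform L x‖ ^ (2 : ℝ) ≤
      (A * (1 + L)⁻¹) ^ s * (A * ((1 + |x|) ^ 2)⁻¹) ^ (2 - s) := by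
    have : ‖profileTransform L x‖ ^ (2 : ℝ) =
        ‖profileTransform L x‖ ^ s * ‖profileTransform L x‖ ^ (2 - s) := by
      rw [← Real.rpow_add_of_nonneg (norm_nonneg _) h0 (by linarith)]; norm_num
    rw [this]
    have := Real.rpow_le_rpow (norm_nonneg _) b1 h0
    have := Real.rpow_le_rpow (norm_nonneg _) b2 (by linarith : 0 ≤ 2 - s)
    gcongr
  rw [← Real.rpow_two]
  refine key.trans (le_of_eq ?_)
  rw [Real.mul_rpow hA0.le (by positivity), Real.mul_rpow hA0.le (by positivity),
    mul_mul_mul_comm, ← Real.rpow_add hA0, ← hA2, Real.inv_rpow hL'.le, ← Real.rpow_neg hL'.le,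
    Real.inv_rpow (by positivity), ← Real.rpow_natCast, ← Real.rpow_mul hx.le,
    ← Real.rpow_neg hx.le]
  norm_num

/-! ### Integrability and weighted square integrability of the generator -/

theorem continuous_profileTransform_uncurry :
    Continuous fun p : ℝ × ℝ => profileTransform p.1 p.2 := by
  unfold profileTransform
  apply intervalIntegral.continuous_parametric_intervalIntegral_of_continuous'
  unfold profile
  fun_prop

/-- The generator `x ↦ ∫₀¹ sin (πt) {nx} ^ (-cos² (πt) / 2) exp (-2πixt) dt` of the shift-invariant
space, where `{nx}` is the fractional part of `nx`. -/
def generator (n : ℕ) (x : ℝ) : ℂ := profileTransform (-Real.log (Int.fract (n * x))) x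

theorem measurable_generator (n : ℕ) : Measurable (generator n) :=
  continuous_profileTransform_uncurry.measurable.comp
    (f := fun x : ℝ => (-Real.log (Int.fract (n * x)), x)) (by fun_prop)

/-- Integers need no separate treatment: there `Real.log 0 = 0` gives the parameter $L=0$. -/
theorem neg_log_fract_nonneg (x : ℝ) : 0 ≤ -Real.log (Int.fract x) :=
  neg_nonneg.2 (Real.log_nonpos (Int.fract_nonneg x) (Int.fract_lt_one x).le)

theorem summable_one_add_abs_int_rpow {a : ℝ} (ha : 1 < a) :
    Summable fun l : ℤ => (1 + |(l : ℝ)|) ^ (-a) := by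
  refine Summable.of_norm_bounded_eventually (Real.summable_abs_int_rpow ha) ?_
  filter_upwards [(Set.finite_singleton (0 : ℤ)).compl_mem_cofinite] with l hl
  have hl : (l : ℝ) ≠ 0 := by simpa using hl
  have : 0 < |(l : ℝ)| := abs_pos.2 hl
  rw [Real.norm_of_nonneg (by positivity)]
  exact Real.rpow_le_rpow_of_nonpos this (by linarith) (by linarith)

/-- After rescaling $X=nx$, each cell $[l,l+1)$ carries a copy of $h$, while the weight is
comparable to $(1+|l|)^{-a}$, which is summable. -/
theorem integrable_comp_fract_mul {h : ℝ → ℝ} (hh : IntegrableOn h (Set.Ioc 0 1)) {n : ℕ}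
    (hn : 1 ≤ n) {a : ℝ} (ha : 1 < a) :
    Integrable fun x : ℝ => h (Int.fract (n * x)) * (1 + |x|) ^ (-a) := by
  have hn' : (1 : ℝ) ≤ n := by exact_mod_cast hn
  suffices H : Integrable fun X : ℝ => h (Int.fract X) * (1 + |X / n|) ^ (-a) by
    have := H.comp_mul_left' (R := (n : ℝ)) (by positivity)
    refine this.congr (ae_of_all _ fun x => ?_)
    simp only
    rw [mul_div_cancel_left₀ _ (by positivity)]
  have hm : ∀ X : ℝ, 0 < 1 + |X / n| := fun X => by positivity
  have hcont : Continuous fun X : ℝ => (1 + |X / n|) ^ (-a) :=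
    Continuous.rpow_const (by fun_prop) fun X => Or.inl (hm X).ne'
  have hcell : ∀ l : ℤ, IntegrableOn (fun X => h (Int.fract X)) (Set.Ico (l : ℝ) (l + 1)) ∧
      ∫ X in Set.Ico (l : ℝ) (l + 1), ‖h (Int.fract X)‖ = ∫ y in Set.Ioc (0 : ℝ) 1, ‖h y‖ := by
    intro l
    have hfr : ∀ X ∈ Set.Ico (l : ℝ) (l + 1), Int.fract X = X - l := fun X hX => by
      rw [Int.fract, Int.floor_eq_iff.2 hX]
    have hi : IntervalIntegrable h volume 0 1 := by
      rwa [intervalIntegrable_iff_integrableOn_Ioc_of_le zero_le_one]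
    constructor
    · have := hi.comp_sub_right (l : ℝ)
      rw [zero_add, add_comm, intervalIntegrable_iff_integrableOn_Ico_of_le (by simp)] at this
      exact this.congr_fun (fun X hX => by simp only [hfr X hX]) measurableSet_Ico
    · rw [setIntegral_congr_fun (g := fun X => ‖h (X - l)‖) measurableSet_Ico
        (fun X hX => by simp only [hfr X hX]), integral_Ico_eq_integral_Ioc,
        ← intervalIntegral.integral_of_le (by simp),
        intervalIntegral.integral_comp_sub_right (fun y => ‖h y‖), sub_self, add_sub_cancel_left,
        intervalIntegral.integral_of_le zero_le_one]
  have hbd : ∀ l : ℤ, ∀ X ∈ Set.Ico (l : ℝ) (l + 1),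
      (1 + |X / n|) ^ (-a) ≤ (2 * n) ^ a * (1 + |(l : ℝ)|) ^ (-a) := by
    intro l X hX
    have h1 : 1 + |(l : ℝ)| ≤ (2 * n) * (1 + |X / n|) := by
      have : |(l : ℝ)| ≤ 1 + |X| := by
        rw [abs_le]
        constructor <;> linarith [hX.1, hX.2, neg_abs_le X, le_abs_self X]
      have h2 : (n : ℝ) * |X / n| = |X| := by
        rw [abs_div, Nat.abs_cast, mul_div_cancel₀ _ (by positivity)]
      nlinarith [abs_nonneg X]
    rw [Real.rpow_neg (hm X).le, Real.rpow_neg (by positivity), ← div_eq_mul_inv,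
      ← Real.div_rpow (by positivity) (by positivity), ← Real.inv_rpow (hm X).le]
    apply Real.rpow_le_rpow (by positivity) _ (by linarith)
    rw [inv_le_comm₀ (by positivity) (by positivity), inv_div, div_le_iff₀ (by positivity)]
    linarith
  have hint : ∀ l : ℤ, IntegrableOn (fun X => h (Int.fract X) * (1 + |X / n|) ^ (-a))
      (Set.Ico (l : ℝ) (l + 1)) := by
    intro l
    refine (hcell l).1.mul_bdd (c := (2 * n) ^ a * (1 + |(l : ℝ)|) ^ (-a))
      hcont.aestronglyMeasurable ?_
    filter_upwards [ae_restrict_mem measurableSet_Ico] with X hX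
    rw [Real.norm_of_nonneg (Real.rpow_nonneg (hm X).le _)]
    exact hbd l X hX
  rw [← integrableOn_univ, ← iUnion_Ico_intCast ℝ]
  refine integrableOn_iUnion_of_summable_integral_norm hint ?_
  refine Summable.of_nonneg_of_le (fun l => integral_nonneg fun X => norm_nonneg _) (fun l => ?_)
    (((summable_one_add_abs_int_rpow ha).mul_left ((2 * n : ℝ) ^ a)).mul_right
      (∫ y in Set.Ioc (0 : ℝ) 1, ‖h y‖))
  rw [← (hcell l).2, ← integral_const_mul]
  refine setIntegral_mono_on (hint l).norm ((hcell l).1.norm.const_mul _) measurableSet_Ico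
    fun X hX => ?_
  rw [norm_mul, mul_comm, Real.norm_of_nonneg (Real.rpow_nonneg (hm X).le _)]
  exact mul_le_mul_of_nonneg_right (hbd l X hX) (norm_nonneg _)

theorem integrableOn_exp_neg_log_half :
    IntegrableOn (fun y => Real.exp (-Real.log y / 2)) (Set.Ioc 0 1) := by
  have h : IntervalIntegrable (fun y : ℝ => y ^ (-(1 / 2) : ℝ)) volume 0 1 :=
    intervalIntegral.intervalIntegrable_rpow' (by norm_num)
  rw [intervalIntegrable_iff_integrableOn_Ioc_of_le zero_le_one] at h
  refine h.congr_fun (fun y hy => ?_) measurableSet_Ioc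
  simp only
  rw [Real.rpow_def_of_pos hy.1]
  ring_nf

/-- The integrand $y^{-1}(1-\log y)^{-s}$ has primitive $(s-1)^{-1}(1-\log y)^{1-s}$, so its
integrals over $[1/(i+1),1]$ stay below $(s-1)^{-1}$. -/
theorem integrableOn_exp_neg_log_mul_rpow {s : ℝ} (hs : 1 < s) :
    IntegrableOn (fun y => Real.exp (-Real.log y) * (1 + -Real.log y) ^ (-s))
      (Set.Ioc 0 1) := by
  have hpos : ∀ {y : ℝ}, 0 < y → y ≤ 1 → 0 < 1 + -Real.log y := fun h0 h1 => by
    have := Real.log_nonpos h0.le h1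
    linarith
  set f : ℝ → ℝ := fun y => Real.exp (-Real.log y) * (1 + -Real.log y) ^ (-s)
  have hcont : ∀ i : ℕ, ContinuousOn f (Set.Icc (1 / ((i : ℝ) + 1)) 1) := by
    intro i
    have hne : ∀ y ∈ Set.Icc (1 / ((i : ℝ) + 1)) 1, 0 < y := fun y hy =>
      lt_of_lt_of_le (by positivity) hy.1
    have hl : ContinuousOn (fun y => -Real.log y) (Set.Icc (1 / ((i : ℝ) + 1)) 1) :=
      (Real.continuousOn_log.mono fun y hy => (hne y hy).ne').neg
    exact (Real.continuous_exp.comp_continuousOn hl).mul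
      ((continuousOn_const.add hl).rpow_const fun y hy => Or.inl (hpos (hne y hy) hy.2).ne')
  have hle : ∀ i : ℕ, 1 / ((i : ℝ) + 1) ≤ 1 := fun i => by
    rw [div_le_one (by positivity)]; linarith [(Nat.cast_nonneg i : (0 : ℝ) ≤ i)]
  refine integrableOn_Ioc_of_intervalIntegral_norm_bounded_left (I := (s - 1)⁻¹)
    (a := fun i : ℕ => 1 / ((i : ℝ) + 1)) (l := Filter.atTop)
    (fun i => (hcont i).integrableOn_Icc.mono_set Set.Ioc_subset_Icc_self)
    tendsto_one_div_add_atTop_nhds_zero_nat (Filter.Eventually.of_forall fun i => ?_)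
  have hi : 0 < 1 / ((i : ℝ) + 1) := by positivity
  rw [← intervalIntegral.integral_of_le (hle i)]
  have h1 : ∫ y in (1 / ((i : ℝ) + 1))..1, ‖f y‖ = ∫ y in (1 / ((i : ℝ) + 1))..1, f y := by
    refine intervalIntegral.integral_congr fun y hy => ?_
    rw [Set.uIcc_of_le (hle i)] at hy
    have := hpos (hi.trans_le hy.1) hy.2
    exact Real.norm_of_nonneg (by positivity)
  have hder : ∀ y ∈ Set.uIcc (1 / ((i : ℝ) + 1)) 1,
      HasDerivAt (fun y => (s - 1)⁻¹ * (1 + -Real.log y) ^ (1 - s)) (f y) y := by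
    intro y hy
    rw [Set.uIcc_of_le (hle i)] at hy
    have hy0 := hi.trans_le hy.1
    have hp := hpos hy0 hy.2
    have := (((Real.hasDerivAt_log hy0.ne').neg.const_add 1).rpow_const (p := 1 - s)
      (Or.inl hp.ne')).const_mul (s - 1)⁻¹
    refine this.congr_deriv ?_
    have hs1 : s - 1 ≠ 0 := by linarith
    simp only [f, Pi.neg_apply]
    rw [Real.exp_neg, Real.exp_log hy0, show 1 - s - 1 = -s by ring]
    field_simp
    ring
  rw [h1, intervalIntegral.integral_eq_sub_of_hasDerivAt hder
    ((hcont i).intervalIntegrable_of_Icc (hle i))]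
  have := hpos hi (hle i)
  have h2 : 0 ≤ (s - 1)⁻¹ * (1 + -Real.log (1 / ((i : ℝ) + 1))) ^ (1 - s) :=
    mul_nonneg (inv_nonneg.2 (by linarith)) (by positivity)
  simp only [Real.log_one, neg_zero, add_zero, Real.one_rpow, mul_one]
  linarith

theorem integrable_generator {n : ℕ} (hn : 1 ≤ n) : Integrable (generator n) := by
  refine ((integrable_comp_fract_mul integrableOn_exp_neg_log_half hn one_lt_two).const_mul
    20).mono' (measurable_generator n).aestronglyMeasurable (ae_of_all _ fun x => ?_)
  refine (norm_profileTransform_le_div_sq (neg_log_fract_nonneg _) x).trans (le_of_eq ?_)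
  rw [Real.rpow_neg (by positivity), Real.rpow_two]

theorem integrable_norm_sq_generator_mul {n : ℕ} (hn : 1 ≤ n) {ε : ℝ} (hε : 0 < ε) :
    Integrable fun x : ℝ => ‖generator n x‖ ^ 2 * (1 + |x|) ^ (1 - ε) := by
  -- Capping $\varepsilon$ keeps $s=1+\delta/4$ in the interpolation range $[0,2]$. The total power
  -- of $1+|x|$ is then $-2(2-s)+(1-\delta)=-(1+\delta/2)$, which is integrable.
  set δ := min ε 1
  have hδ : 0 < δ := lt_min hε one_pos
  have hδ1 : δ ≤ 1 := min_le_right _ _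
  have hm : Measurable fun x : ℝ => ‖generator n x‖ ^ 2 * (1 + |x|) ^ (1 - ε) :=
    ((measurable_generator n).norm.pow_const 2).mul (by fun_prop)
  refine ((integrable_comp_fract_mul (integrableOn_exp_neg_log_mul_rpow
    (s := 1 + δ / 4) (by linarith)) hn (a := 1 + δ / 2) (by linarith)).const_mul
    400).mono' hm.aestronglyMeasurable (ae_of_all _ fun x => ?_)
  have hx : 0 < 1 + |x| := by positivity
  rw [Real.norm_of_nonneg (by positivity)]
  have h1 := norm_sq_profileTransform_le (neg_log_fract_nonneg (n * x)) x (s := 1 + δ / 4)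
    (by linarith) (by linarith)
  have h2 : (1 + |x|) ^ (1 - ε) ≤ (1 + |x|) ^ (1 - δ) :=
    Real.rpow_le_rpow_of_exponent_le (by linarith [abs_nonneg x])
      (by linarith [min_le_left ε 1])
  refine (mul_le_mul h1 h2 (by positivity) (by
    have := neg_log_fract_nonneg (n * x); positivity)).trans (le_of_eq ?_)
  have h3 : (1 + |x|) ^ (-(1 + δ / 2)) =
      (1 + |x|) ^ (-(2 * (2 - (1 + δ / 4)))) * (1 + |x|) ^ (1 - δ) := by
    rw [← Real.rpow_add hx]; ring_nf
  rw [h3]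
  ring

theorem memLp_one_generator {n : ℕ} (hn : 1 ≤ n) : MemLp (generator n) 1 volume :=
  memLp_one_iff_integrable.2 (integrable_generator hn)

theorem memLp_two_generator {n : ℕ} (hn : 1 ≤ n) : MemLp (generator n) 2 volume := by
  rw [memLp_two_iff_integrable_sq_norm (measurable_generator n).aestronglyMeasurable]
  simpa using integrable_norm_sq_generator_mul hn one_pos

/-! ### Periodization, Parseval, and inner products of translates -/

theorem integral_eq_integral_of_hasSum_comp_add_int {f : ℝ → ℂ} (hf : Integrable f) {n : ℕ}
    (hn : 1 ≤ n) {S : ℝ → ℂ}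
    (hS : ∀ Y ∈ Set.Ioo (0 : ℝ) 1, HasSum (fun l : ℤ => f ((Y + l) / n)) (S Y)) :
    ∫ x, f x = (n : ℂ)⁻¹ * ∫ Y in (0 : ℝ)..1, S Y := by
  have hn0 : (n : ℝ) ≠ 0 := by positivity
  have hnC : (n : ℂ) ≠ 0 := by exact_mod_cast hn0
  have hg : Integrable fun X : ℝ => f (X / n) := hf.comp_div hn0
  have h1 : ∫ X : ℝ, f (X / n) = n * ∫ x, f x := by
    rw [Measure.integral_comp_div]
    simp
  have h2 := hg.hasSum_intervalIntegral_comp_add_int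
  have h3 : HasSum (fun l : ℤ => ∫ Y in (0 : ℝ)..1, f ((Y + l) / n))
      (∫ Y in (0 : ℝ)..1, ∑' l : ℤ, f ((Y + l) / n)) := by
    simp only [intervalIntegral.integral_of_le zero_le_one]
    refine hasSum_integral_of_summable_integral_norm (fun l => ?_) ?_
    · exact (hg.comp_add_right (l : ℝ)).integrableOn
    · have := hg.norm.hasSum_intervalIntegral_comp_add_int.summable
      simpa only [intervalIntegral.integral_of_le zero_le_one] using this
  have h4 : ∫ Y in (0 : ℝ)..1, ∑' l : ℤ, f ((Y + l) / n) = ∫ Y in (0 : ℝ)..1, S Y :=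
    intervalIntegral.integral_congr_Ioo_of_le zero_le_one fun Y hY => (hS Y hY).tsum_eq
  rw [← h4, ← h3.unique h2 |>.symm, h1, inv_mul_cancel_left₀ hnC]

theorem hasSum_conj_fourierCoeff_mul {T : ℝ} [Fact (0 < T)] (f g : C(AddCircle T, ℂ)) :
    HasSum (fun l : ℤ => fourierCoeff g l * (starRingEnd ℂ) (fourierCoeff f l))
      (∫ t, g t * (starRingEnd ℂ) (f t) ∂AddCircle.haarAddCircle) := by
  have := (fourierBasis (T := T)).hasSum_inner_mul_inner
    (ContinuousMap.toLp (E := ℂ) 2 AddCircle.haarAddCircle ℂ f)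
    (ContinuousMap.toLp (E := ℂ) 2 AddCircle.haarAddCircle ℂ g)
  rw [ContinuousMap.inner_toLp] at this
  have key : ∀ l, inner ℂ (ContinuousMap.toLp (E := ℂ) 2 AddCircle.haarAddCircle ℂ f)
      (fourierBasis l) * inner ℂ (fourierBasis l)
        (ContinuousMap.toLp (E := ℂ) 2 AddCircle.haarAddCircle ℂ g) =
      fourierCoeff g l * (starRingEnd ℂ) (fourierCoeff f l) := fun l => by
    rw [← fourierBasis.repr_apply_apply, ← inner_conj_symm, ← fourierBasis.repr_apply_apply,
      fourierBasis_repr, fourierBasis_repr, fourierCoeff_toLp, fourierCoeff_toLp, mul_comm]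
  rwa [funext key] at this

theorem fourierCoeff_fourier_mul {T : ℝ} [Fact (0 < T)] (f : AddCircle T → ℂ) (m l : ℤ) :
    fourierCoeff (fun t => fourier m t * f t) l = fourierCoeff f (l - m) := by
  unfold fourierCoeff
  congr 1
  ext t
  rw [smul_eq_mul, smul_eq_mul, ← mul_assoc, ← fourier_add]
  congr 3
  ring

/-- The modulated profile on the circle of length `n`, supported in the unit interval. -/
def circleProfile (n : ℕ) [Fact (0 < (n : ℝ))] (L Y : ℝ) : C(AddCircle (n : ℝ), ℂ) where
  toFun := AddCircle.liftIco (n : ℝ) 0 fun x => if x ≤ 1 then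
    (profile L x : ℂ) * Complex.exp (-(2 * Real.pi * (Y / n) * x : ℝ) * Complex.I) else 0
  continuous_toFun := by
    have hn : 1 ≤ n := by exact_mod_cast (Fact.out : 0 < (n : ℝ))
    have hp := continuous_profile L
    refine AddCircle.liftIco_zero_continuous ?_ (Continuous.continuousOn ?_)
    -- For $n=1$ the point $x=1$ is glued to $0$, and continuity needs the profile to vanish at both
    -- ends; for $n>1$ the function is already zero near $x=n$.
    · rcases hn.eq_or_lt with h | h
      · simp [profile_zero, ← h, profile_one]
      · have : ¬ (n : ℝ) ≤ 1 := by push Not; exact_mod_cast h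
        simp [profile_zero, this]
    · refine Continuous.if_le (by fun_prop) (by fun_prop) continuous_id continuous_const ?_
      rintro x rfl
      simp [profile_one]

theorem circleProfile_coe {n : ℕ} [Fact (0 < (n : ℝ))] (L Y : ℝ) {x : ℝ}
    (hx : x ∈ Set.Ico (0 : ℝ) n) : circleProfile n L Y (x : AddCircle (n : ℝ)) = if x ≤ 1 then
    (profile L x : ℂ) * Complex.exp (-(2 * Real.pi * (Y / n) * x : ℝ) * Complex.I) else 0 :=
  AddCircle.liftIco_zero_coe_apply (f := fun x : ℝ => if x ≤ 1 then
    (profile L x : ℂ) * Complex.exp (-(2 * Real.pi * (Y / n) * x : ℝ) * Complex.I) else 0) hx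

theorem integral_haarAddCircle_eq_of_support {n : ℕ} [hT : Fact (0 < (n : ℝ))]
    {f : AddCircle (n : ℝ) → ℂ} {g : ℝ → ℂ} (hf : ∀ x ∈ Set.Ico (0 : ℝ) n, f x = if x ≤ 1 then g x else 0) :
    ∫ t, f t ∂AddCircle.haarAddCircle = (n : ℂ)⁻¹ * ∫ x in (0 : ℝ)..1, g x := by
  have hn : (1 : ℝ) ≤ n := by
    have : 1 ≤ n := by exact_mod_cast (Fact.out : 0 < (n : ℝ))
    exact_mod_cast this
  rw [AddCircle.integral_haarAddCircle, ← AddCircle.intervalIntegral_preimage (n : ℝ) 0, zero_add,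
    Complex.real_smul, Complex.ofReal_inv, Complex.ofReal_natCast]
  congr 1
  have h1 : ∫ x in (0 : ℝ)..n, f x = ∫ x in (0 : ℝ)..n, if x ≤ 1 then g x else 0 :=
    intervalIntegral.integral_congr_Ioo_of_le (by linarith) fun x hx =>
      hf x (Set.Ioo_subset_Ico_self hx)
  have h2 : ∫ x in (0 : ℝ)..n, (if x ≤ 1 then g x else 0) =
      ∫ x in (0 : ℝ)..n, (Set.Ioc (0 : ℝ) 1).indicator g x := by
    refine intervalIntegral.integral_congr_Ioo_of_le (by linarith) fun x hx => ?_
    simp only [Set.indicator, Set.mem_Ioc, hx.1, true_and]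
  rw [h1, h2, intervalIntegral.integral_of_le (by linarith), setIntegral_indicator measurableSet_Ioc,
    intervalIntegral.integral_of_le zero_le_one,
    Set.inter_eq_self_of_subset_right (Set.Ioc_subset_Ioc_right hn)]

theorem fourierCoeff_circleProfile {n : ℕ} [Fact (0 < (n : ℝ))] (L Y : ℝ) (l : ℤ) :
    fourierCoeff (circleProfile n L Y) l = (n : ℂ)⁻¹ * profileTransform L ((Y + l) / n) := by
  have hp := continuous_profile L
  have hn : (n : ℝ) ≠ 0 := (Fact.out : 0 < (n : ℝ)).ne'
  refine integral_haarAddCircle_eq_of_support fun x hx => ?_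
  rw [circleProfile_coe L Y hx]
  split_ifs
  · rw [smul_eq_mul, mul_left_comm, fourier_coe_apply, ← Complex.exp_add]
    congr 2
    have : (n : ℂ) ≠ 0 := by exact_mod_cast hn
    push_cast
    field_simp
    ring
  · simp

/-- Parseval for the modulated profile against its product with the $m$-th character, which shifts
coefficients by $m$. The modulation by $Y$ cancels, so the sum does not depend on $Y$ when $L$ is
fixed. -/
theorem hasSum_profileTransform_mul_conj {n : ℕ} (hn : 1 ≤ n) (L Y : ℝ) (m : ℤ) :
    HasSum (fun l : ℤ => profileTransform L ((Y + l) / n - m / n) *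
        (starRingEnd ℂ) (profileTransform L ((Y + l) / n)))
      (n * ∫ t in (0 : ℝ)..1,
        ((profile L t ^ 2 : ℝ) : ℂ) * Complex.exp ((2 * Real.pi * (m / n) * t : ℝ) * Complex.I)) := by
  have hn0 : (0 : ℝ) < n := by exact_mod_cast hn
  have hnC : (n : ℂ) ≠ 0 := by exact_mod_cast hn0.ne'
  have : Fact (0 < (n : ℝ)) := ⟨hn0⟩
  have hp := continuous_profile L
  have h := hasSum_conj_fourierCoeff_mul (circleProfile n L Y) (fourier m * circleProfile n L Y)
  rw [integral_haarAddCircle_eq_of_support (g := fun t => ((profile L t ^ 2 : ℝ) : ℂ) *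
    Complex.exp ((2 * Real.pi * (m / n) * t : ℝ) * Complex.I))] at h
  · have key : ∀ l : ℤ, profileTransform L ((Y + l) / n - m / n) *
        (starRingEnd ℂ) (profileTransform L ((Y + l) / n)) = (n : ℂ) ^ 2 *
        (fourierCoeff (fourier m * circleProfile n L Y : C(AddCircle (n : ℝ), ℂ)) l *
          (starRingEnd ℂ) (fourierCoeff (circleProfile n L Y) l)) := by
      intro l
      have : fourierCoeff (fourier m * circleProfile n L Y : C(AddCircle (n : ℝ), ℂ)) l =
        fourierCoeff (circleProfile n L Y) (l - m) := fourierCoeff_fourier_mul _ m l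
      rw [this, fourierCoeff_circleProfile, fourierCoeff_circleProfile, map_mul, map_inv₀,
        Complex.conj_natCast, ← sub_div]
      push_cast
      rw [add_sub_assoc]
      field_simp
    rw [funext key]
    have h' := h.mul_left ((n : ℂ) ^ 2)
    rwa [← mul_assoc, sq, mul_inv_cancel_right₀ hnC, ← sq] at h'
  · intro x hx
    rw [ContinuousMap.mul_apply, circleProfile_coe L Y hx]
    split_ifs
    · rw [map_mul, Complex.conj_ofReal, ← Complex.exp_conj, map_mul, map_neg, Complex.conj_ofReal,
        Complex.conj_I, fourier_coe_apply]
      have e1 : ∀ θ : ℂ, Complex.exp (-θ * Complex.I) * Complex.exp (-θ * -Complex.I) = 1 := by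
        intro θ
        rw [← Complex.exp_add]
        simp
      have e2 : Complex.exp (2 * Real.pi * Complex.I * m * x / (n : ℝ)) =
          Complex.exp ((2 * Real.pi * (m / n) * x : ℝ) * Complex.I) := by
        congr 1
        push_cast
        ring
      rw [e2]
      push_cast
      linear_combination (Complex.exp ((2 * Real.pi * (m / n) * x : ℂ) * Complex.I) *
        (profile L x : ℂ) ^ 2) * e1 (2 * Real.pi * (Y / n) * x)
    · simp

theorem sq_profile_neg_log {t Y : ℝ} (hY : 0 < Y) :
    profile (-Real.log Y) t ^ 2 =
      Real.sin (Real.pi * t) ^ 2 * Y ^ (Real.sin (Real.pi * t) ^ 2 - 1) := by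
  rw [profile, mul_pow, ← Real.exp_nat_mul, Real.rpow_def_of_pos hY, Real.sin_sq]
  congr 2
  push_cast
  ring

/-- This normalization dictates the choice of profile: $\int_0^1 sY^{s-1}dY=1$ for every
$s=\sin^2(\pi t)>0$. -/
theorem integral_sq_profile_neg_log {t : ℝ} (ht : t ∈ Set.Ioo (0 : ℝ) 1) :
    IntegrableOn (fun Y => profile (-Real.log Y) t ^ 2) (Set.Ioc 0 1) ∧
      ∫ Y in Set.Ioc (0 : ℝ) 1, profile (-Real.log Y) t ^ 2 = 1 := by
  have hs : 0 < Real.sin (Real.pi * t) ^ 2 := by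
    have := Real.sin_pos_of_pos_of_lt_pi (x := Real.pi * t) (mul_pos Real.pi_pos ht.1)
      (by nlinarith [Real.pi_pos, ht.2])
    positivity
  set s := Real.sin (Real.pi * t) ^ 2
  have hi : IntegrableOn (fun Y : ℝ => Y ^ (s - 1)) (Set.Ioc 0 1) := by
    rw [← intervalIntegrable_iff_integrableOn_Ioc_of_le zero_le_one]
    exact intervalIntegral.intervalIntegrable_rpow' (by linarith)
  have he : Set.EqOn (fun Y => s * Y ^ (s - 1)) (fun Y => profile (-Real.log Y) t ^ 2)
      (Set.Ioc 0 1) := fun Y hY => (sq_profile_neg_log hY.1).symm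
  refine ⟨IntegrableOn.congr_fun (hi.const_mul s) he measurableSet_Ioc, ?_⟩
  rw [← setIntegral_congr_fun measurableSet_Ioc he, integral_const_mul,
    ← intervalIntegral.integral_of_le zero_le_one, integral_rpow (Or.inl (by linarith))]
  rw [sub_add_cancel, Real.one_rpow, Real.zero_rpow hs.ne', sub_zero, mul_one_div_cancel hs.ne']

theorem integral_integral_sq_profile_mul {g : ℝ → ℂ} (hg : Continuous g) (hg1 : ∀ t, ‖g t‖ = 1) :
    ∫ Y in (0 : ℝ)..1, ∫ t in (0 : ℝ)..1, ((profile (-Real.log Y) t ^ 2 : ℝ) : ℂ) * g t =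
      ∫ t in (0 : ℝ)..1, g t := by
  simp only [intervalIntegral.integral_of_le zero_le_one]
  have hmeas : Measurable fun p : ℝ × ℝ => ((profile (-Real.log p.1) p.2 ^ 2 : ℝ) : ℂ) * g p.2 := by
    unfold profile
    have := hg.measurable
    fun_prop
  -- At $t=1$ the sine vanishes and the $Y$-integral is $0$ instead of $1$; this endpoint is
  -- discarded as a null set.
  have hae : ∀ᵐ t ∂(volume.restrict (Set.Ioc (0 : ℝ) 1)), t ∈ Set.Ioo (0 : ℝ) 1 := by
    rw [← restrict_Ioo_eq_restrict_Ioc]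
    exact ae_restrict_mem measurableSet_Ioo
  have hint : Integrable (Function.uncurry fun Y t => ((profile (-Real.log Y) t ^ 2 : ℝ) : ℂ) * g t)
      ((volume.restrict (Set.Ioc (0 : ℝ) 1)).prod (volume.restrict (Set.Ioc (0 : ℝ) 1))) := by
    rw [integrable_prod_iff' (by exact hmeas.aestronglyMeasurable)]
    constructor
    · filter_upwards [hae] with t ht
      exact ((integral_sq_profile_neg_log ht).1.ofReal (𝕜 := ℂ)).mul_const (g t)
    · refine (integrable_const (1 : ℝ)).congr ?_
      filter_upwards [hae] with t ht
      refine (integral_sq_profile_neg_log ht).2.symm.trans ?_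
      refine integral_congr_ae (ae_of_all _ fun Y => ?_)
      simp [Function.uncurry, hg1]
  rw [integral_integral_swap hint]
  refine integral_congr_ae ?_
  filter_upwards [hae] with t ht
  rw [integral_mul_const, integral_complex_ofReal, (integral_sq_profile_neg_log ht).2]
  simp

theorem generator_add_int_div {n : ℕ} (hn : 1 ≤ n) {Y : ℝ} (hY : Y ∈ Set.Ioo (0 : ℝ) 1) (l : ℤ) :
    generator n ((Y + l) / n) = profileTransform (-Real.log Y) ((Y + l) / n) := by
  have hn0 : (n : ℝ) ≠ 0 := by positivity
  rw [generator, mul_div_cancel₀ _ hn0, Int.fract_add_intCast,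
    Int.fract_eq_self.2 ⟨hY.1.le, hY.2⟩]

theorem integral_generator_sub_mul_conj {n : ℕ} (hn : 1 ≤ n) (m : ℤ) :
    ∫ x, generator n (x - m / n) * (starRingEnd ℂ) (generator n x) =
      ∫ t in (0 : ℝ)..1, Complex.exp ((2 * Real.pi * (m / n) * t : ℝ) * Complex.I) := by
  have hn0 : (n : ℝ) ≠ 0 := by positivity
  have hnC : (n : ℂ) ≠ 0 := by exact_mod_cast hn0
  have h2 := memLp_two_generator hn
  have hint : Integrable fun x => generator n (x - m / n) * (starRingEnd ℂ) (generator n x) :=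
    (h2.comp_measurePreserving (measurePreserving_sub_right volume ((m : ℝ) / n))).integrable_mul
      h2.star
  rw [integral_eq_integral_of_hasSum_comp_add_int hint hn (S := fun Y => n * ∫ t in (0 : ℝ)..1,
    ((profile (-Real.log Y) t ^ 2 : ℝ) : ℂ) *
      Complex.exp ((2 * Real.pi * (m / n) * t : ℝ) * Complex.I)),
    intervalIntegral.integral_const_mul, inv_mul_cancel_left₀ hnC,
    integral_integral_sq_profile_mul (by fun_prop) fun t => Complex.norm_exp_ofReal_mul_I _]
  intro Y hY
  convert hasSum_profileTransform_mul_conj hn (-Real.log Y) Y m using 3 with l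
  · rw [← sub_div, add_sub_assoc, ← Int.cast_sub, generator_add_int_div hn hY]
  · rw [generator_add_int_div hn hY]

/-! ### Closed spans, orthonormality, and fractional invariance -/

theorem Orthonormal.norm_sub_sum_inner_smul_sq {ι E : Type*} [NormedAddCommGroup E]
    [InnerProductSpace ℂ E] {v : ι → E} (hv : Orthonormal ℂ v) (x : E) (s : Finset ι) :
    ‖x - ∑ i ∈ s, inner ℂ (v i) x • v i‖ ^ 2 = ‖x‖ ^ 2 - ∑ i ∈ s, ‖inner ℂ (v i) x‖ ^ 2 := by
  have h₂ : (∑ i ∈ s, ∑ j ∈ s, inner ℂ (v i) x * inner ℂ x (v j) * inner ℂ (v j) (v i)) =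
      (∑ k ∈ s, inner ℂ (v k) x * inner ℂ x (v k) : ℂ) := hv.inner_left_right_finset
  have h₃ : ∀ z : ℂ, RCLike.re (z * (starRingEnd ℂ) z) = ‖z‖ ^ 2 := by
    intro z
    simp only [RCLike.mul_conj]
    norm_cast
  rw [@norm_sub_sq ℂ, sub_add]
  simp only [@InnerProductSpace.norm_sq_eq_re_inner ℂ E, inner_sum, sum_inner]
  simp only [inner_smul_right, two_mul, inner_smul_left, inner_conj_symm, ← mul_assoc, h₂,
    add_sub_cancel_right, sub_right_inj]
  simp only [map_sum, ← inner_conj_symm x, ← h₃]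

/-- Equality in Bessel's inequality makes the squared distance to the partial expansions tend to
zero. -/
theorem Orthonormal.mem_closure_span_of_hasSum_norm_sq {ι E : Type*} [NormedAddCommGroup E]
    [InnerProductSpace ℂ E] {v : ι → E} (hv : Orthonormal ℂ v) {x : E}
    (h : HasSum (fun i => ‖inner ℂ (v i) x‖ ^ 2) (‖x‖ ^ 2)) :
    x ∈ (Submodule.span ℂ (Set.range v)).topologicalClosure := by
  have h1 : Filter.Tendsto (fun s : Finset ι => ‖(∑ i ∈ s, inner ℂ (v i) x • v i) - x‖)
      Filter.atTop (nhds 0) := by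
    have h2 : Filter.Tendsto (fun s : Finset ι => √(‖x‖ ^ 2 - ∑ i ∈ s, ‖inner ℂ (v i) x‖ ^ 2))
        Filter.atTop (nhds 0) := by
      have h3 : Filter.Tendsto (fun s : Finset ι => ∑ i ∈ s, ‖inner ℂ (v i) x‖ ^ 2)
        Filter.atTop (nhds (‖x‖ ^ 2)) := h
      have h4 := (h3.const_sub (‖x‖ ^ 2)).sqrt
      rwa [sub_self, Real.sqrt_zero] at h4
    refine h2.congr fun s => ?_
    rw [← hv.norm_sub_sum_inner_smul_sq, Real.sqrt_sq (norm_nonneg _), norm_sub_rev]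
  refine mem_closure_of_tendsto (tendsto_iff_norm_sub_tendsto_zero.2 h1)
    (Filter.Eventually.of_forall fun s => ?_)
  exact Submodule.sum_mem _ fun i _ =>
    Submodule.smul_mem _ _ (Submodule.subset_span (Set.mem_range_self i))

/-- For an orthonormal family, synthesis is an isometry of $\ell^2$ whose range is the closed span.
-/
theorem V2_eq_topologicalClosure {Φ : L2R}
    (h : Orthonormal ℂ fun k : ℤ => translateL2 (k : ℝ) Φ) :
    (Submodule.span ℂ (Set.range fun k : ℤ => translateL2 (k : ℝ) Φ)).topologicalClosure =
      V2 Φ := by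
  have hr := h.orthogonalFamily.range_linearIsometry
  have hs : (⨆ k, LinearMap.range (LinearIsometry.toSpanSingleton ℂ L2R (h.1 k)).toLinearMap) =
      Submodule.span ℂ (Set.range fun k : ℤ => translateL2 (k : ℝ) Φ) := by
    simp [← LinearMap.span_singleton_eq_range, ← Submodule.span_iUnion]
  rw [hs] at hr
  refine le_antisymm (fun f hf => ?_) ?_
  · rw [← hr] at hf
    obtain ⟨c, rfl⟩ := hf
    exact ⟨c, by simpa using h.orthogonalFamily.hasSum_linearIsometry c⟩
  · rintro f ⟨c, hc⟩
    refine mem_closure_of_tendsto hc (Filter.Eventually.of_forall fun s => ?_)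
    exact Submodule.sum_mem _ fun i _ =>
      Submodule.smul_mem _ _ (Submodule.subset_span (Set.mem_range_self i))

theorem translateL2_toLp {φ : ℝ → ℂ} (h : MemLp φ 2 volume) (t : ℝ) :
    translateL2 t (h.toLp φ) =
      (h.comp_measurePreserving (measurePreserving_sub_right volume t)).toLp _ := rfl

theorem translateL2_translateL2 (s t : ℝ) (f : L2R) :
    translateL2 s (translateL2 t f) = translateL2 (s + t) f := by
  unfold translateL2
  rw [← Lp.compMeasurePreserving_comp_apply]
  congr 2
  ext x
  simp [sub_sub]

theorem inner_translateL2_toLp {φ : ℝ → ℂ} (h : MemLp φ 2 volume) (s t : ℝ) :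
    inner ℂ (translateL2 s (h.toLp φ)) (translateL2 t (h.toLp φ)) =
      ∫ x, φ (x - (t - s)) * (starRingEnd ℂ) (φ x) := by
  rw [L2.inner_def, ← integral_sub_right_eq_self (fun x => φ (x - (t - s)) * _) s]
  refine integral_congr_ae ?_
  rw [translateL2_toLp, translateL2_toLp]
  filter_upwards [(h.comp_measurePreserving (measurePreserving_sub_right volume s)).coeFn_toLp,
    (h.comp_measurePreserving (measurePreserving_sub_right volume t)).coeFn_toLp] with x hs ht
  rw [hs, ht, RCLike.inner_apply]
  simp only [Function.comp_apply]
  ring_nf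

theorem inner_translateL2_generator {n : ℕ} (hn : 1 ≤ n) (h : MemLp (generator n) 2 volume)
    (k m : ℤ) :
    inner ℂ (translateL2 (k : ℝ) (h.toLp _)) (translateL2 ((m : ℝ) / n) (h.toLp _)) =
      ∫ t in (0 : ℝ)..1,
        Complex.exp ((2 * Real.pi * ((m : ℝ) / n - k) * t : ℝ) * Complex.I) := by
  have hn0 : (n : ℝ) ≠ 0 := by positivity
  have e : (m : ℝ) / n - k = ((m - n * k : ℤ) : ℝ) / n := by
    push_cast
    field_simp
  rw [inner_translateL2_toLp, e, integral_generator_sub_mul_conj hn]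

theorem integral_exp_two_pi_int_mul (j : ℤ) :
    ∫ t in (0 : ℝ)..1, Complex.exp ((2 * Real.pi * (j : ℝ) * t : ℝ) * Complex.I) =
      if j = 0 then 1 else 0 := by
  split_ifs with hj
  · simp [hj]
  · have hc : (2 * Real.pi * j * Complex.I : ℂ) ≠ 0 := by
      simp [hj, Real.pi_ne_zero]
    have := integral_exp_mul_complex (a := 0) (b := 1) hc
    have h1 : Complex.exp (2 * Real.pi * j * Complex.I) = 1 := by
      rw [← Complex.exp_int_mul_two_pi_mul_I j]
      ring_nf
    simp only [Complex.ofReal_one, mul_one, h1, Complex.ofReal_zero, mul_zero, Complex.exp_zero,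
      sub_self, zero_div] at this
    rw [← this]
    refine intervalIntegral.integral_congr fun t _ => ?_
    congr 1
    push_cast
    ring

theorem orthonormal_translateL2_generator {n : ℕ} (hn : 1 ≤ n)
    (h : MemLp (generator n) 2 volume) :
    Orthonormal ℂ fun k : ℤ => translateL2 (k : ℝ) (h.toLp (generator n)) := by
  have hn0 : (n : ℝ) ≠ 0 := by positivity
  rw [orthonormal_iff_ite]
  intro k m
  have := inner_translateL2_generator hn h k (n * m)
  rw [Int.cast_mul, Int.cast_natCast, mul_div_cancel_left₀ _ hn0, ← Int.cast_sub,
    integral_exp_two_pi_int_mul] at this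
  rw [this]
  simp only [sub_eq_zero, eq_comm]

/-- Parseval on $[0,1]$ for the unimodular function $e^{2\pi iat}$; with $a=m/n$ it yields the
Bessel equality for $\phi(\cdot-m/n)$. -/
theorem hasSum_norm_sq_integral_exp (a : ℝ) :
    HasSum (fun k : ℤ => ‖∫ t in (0 : ℝ)..1,
      Complex.exp ((2 * Real.pi * (a - k) * t : ℝ) * Complex.I)‖ ^ 2) 1 := by
  set f : ℝ → ℂ := fun t => Complex.exp ((2 * Real.pi * a * t : ℝ) * Complex.I)
  have hf : Continuous f := by simp only [f]; fun_prop
  have hf1 : ∀ t, ‖f t‖ = 1 := fun t => Complex.norm_exp_ofReal_mul_I _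
  have hm : MemLp f 2 (volume.restrict (Set.Ioc (0 : ℝ) 1)) :=
    MemLp.of_bound hf.aestronglyMeasurable 1 (ae_of_all _ fun t => (hf1 t).le)
  have := hasSum_sq_fourierCoeffOn zero_lt_one hm
  simp only [hf1, sub_zero, inv_one, one_pow, intervalIntegral.integral_const, smul_eq_mul,
    mul_one] at this
  have key : ∀ k : ℤ, ‖fourierCoeffOn zero_lt_one f k‖ ^ 2 = ‖∫ t in (0 : ℝ)..1,
      Complex.exp ((2 * Real.pi * (a - k) * t : ℝ) * Complex.I)‖ ^ 2 := by
    intro k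
    rw [fourierCoeffOn_eq_integral]
    simp only [sub_zero, div_one, one_smul]
    congr 2
    refine intervalIntegral.integral_congr fun t _ => ?_
    simp only [f, fourier_coe_apply, smul_eq_mul]
    rw [← Complex.exp_add]
    congr 1
    push_cast
    ring
  rwa [funext key] at this

theorem translateL2_div_generator_mem {n : ℕ} (hn : 1 ≤ n) (h : MemLp (generator n) 2 volume)
    (m : ℤ) : translateL2 ((m : ℝ) / n) (h.toLp (generator n)) ∈ V2 (h.toLp (generator n)) := by
  have ho := orthonormal_translateL2_generator hn h
  rw [← V2_eq_topologicalClosure ho]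
  refine ho.mem_closure_span_of_hasSum_norm_sq ?_
  have h1 : ‖translateL2 ((m : ℝ) / n) (h.toLp (generator n))‖ = 1 := by
    have h2 := ho.1 0
    have h3 : ∀ t, ‖translateL2 t (h.toLp (generator n))‖ = ‖h.toLp (generator n)‖ := fun t =>
      Lp.norm_compMeasurePreserving _ _
    rw [h3] at h2 ⊢
    exact h2
  rw [h1, one_pow]
  simp only [inner_translateL2_generator hn h]
  exact hasSum_norm_sq_integral_exp _

theorem isOrthonormalGenerator_generator {n : ℕ} (hn : 1 ≤ n)
    (h : MemLp (generator n) 2 volume) : IsOrthonormalGenerator (h.toLp (generator n)) :=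
  ⟨orthonormal_translateL2_generator hn h,
    V2_eq_topologicalClosure (orthonormal_translateL2_generator hn h)⟩

theorem isFracInvariant_generator {n : ℕ} (hn : 1 ≤ n) (h : MemLp (generator n) 2 volume) :
    IsFracInvariant n (V2 (h.toLp (generator n))) := by
  have hn0 : (n : ℝ) ≠ 0 := by positivity
  intro m f hf
  have hV := V2_eq_topologicalClosure (orthonormal_translateL2_generator hn h)
  let T := Lp.compMeasurePreservingₗᵢ (E := ℂ) (p := 2) ℂ (fun x : ℝ => x - (m : ℝ) / n)
    (measurePreserving_sub_right volume ((m : ℝ) / n))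
  change T f ∈ V2 (h.toLp (generator n))
  have hclosed : IsClosed (V2 (h.toLp (generator n)) : Set L2R) := by
    rw [← hV]
    exact Submodule.isClosed_topologicalClosure _
  have hle : (Submodule.span ℂ (Set.range fun k : ℤ =>
      translateL2 (k : ℝ) (h.toLp (generator n)))).topologicalClosure ≤
      (V2 (h.toLp (generator n))).comap T.toLinearMap := by
    refine Submodule.topologicalClosure_minimal _ ?_ (hclosed.preimage T.continuous)
    rw [Submodule.span_le]
    rintro _ ⟨k, rfl⟩
    change translateL2 ((m : ℝ) / n) (translateL2 (k : ℝ) _) ∈ V2 _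
    rw [translateL2_translateL2]
    -- Translating $\phi(\cdot-k)$ by $m/n$ gives the translate of $\phi$ by $(m+nk)/n$, so the case
    -- of the generator itself suffices.
    have := translateL2_div_generator_mem hn h (m + n * k)
    have e : ((m + n * k : ℤ) : ℝ) / n = (m : ℝ) / n + k := by
      push_cast
      field_simp
    rwa [e] at this
  rw [hV] at hle
  exact hle hf

/-! ### Decay of the Fourier transform -/

theorem norm_intervalIntegral_rpow_mul_le {a b p : ℝ} (hab : a ≤ b) (hp : -1 < p)
    {c e : ℝ → ℂ} (hc : ∀ Y ∈ Set.Ioc a b, ‖c Y‖ ≤ Y ^ p) (he : ∀ Y, ‖e Y‖ = 1) :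
    ‖∫ Y in a..b, c Y * e Y‖ ≤ (b ^ (p + 1) - a ^ (p + 1)) / (p + 1) := by
  rw [← integral_rpow (Or.inl hp)]
  refine intervalIntegral.norm_integral_le_of_norm_le hab (ae_of_all _ fun Y hY => ?_)
    (intervalIntegral.intervalIntegrable_rpow' hp)
  rw [norm_mul, he, mul_one]
  exact hc Y hY

/-- Split at $d=1/|\kappa|$. On $[0,d]$ the size of the integrand gives $2d^{1/2}$. On $[d,1]$
integration by parts, with $Y^{-\alpha}$ monotone, gives $d^{1-\alpha}/\pi\le d^{1/2}$. -/
theorem norm_integral_rpow_mul_exp_le {α : ℝ} (h0 : 0 ≤ α) (h1 : α ≤ 1 / 2) {κ : ℝ}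
    (hκ : 1 ≤ |κ|) :
    ‖∫ Y in (0 : ℝ)..1, ((Y ^ (-α) : ℝ) : ℂ) *
      Complex.exp ((2 * Real.pi * κ * Y : ℝ) * Complex.I)‖ ≤ 3 * (1 / |κ|) ^ (1 / 2 : ℝ) := by
  have hpi := Real.pi_gt_three
  have hκ0 : κ ≠ 0 := by
    rintro rfl
    norm_num at hκ
  set d := 1 / |κ| with hd
  have hd0 : 0 < d := by positivity
  have hd1 : d ≤ 1 := by rw [hd, div_le_one (by positivity)]; exact hκ
  set e : ℝ → ℂ := fun Y => Complex.exp ((2 * Real.pi * κ * Y : ℝ) * Complex.I)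
  have hne : ∀ Y, ‖e Y‖ = 1 := fun Y => Complex.norm_exp_ofReal_mul_I _
  have hec : Continuous e := by simp only [e]; fun_prop
  set w : ℂ := (2 * Real.pi * κ : ℝ) * Complex.I
  have hw0 : w ≠ 0 := by simp [w, hκ0, Real.pi_ne_zero]
  have hwn : ‖w⁻¹‖ = d / (2 * Real.pi) := by
    simp only [w, norm_inv, norm_mul, Complex.norm_real, Complex.norm_I, mul_one, Real.norm_eq_abs,
      abs_of_pos Real.pi_pos, abs_two, hd]
    field_simp
  have hee : ∀ Y, HasDerivAt e (e Y * w) Y := fun Y => by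
    have : HasDerivAt (fun Y : ℝ => ((2 * Real.pi * κ * Y : ℝ) * Complex.I : ℂ)) w Y := by
      have := (((hasDerivAt_id Y).const_mul (2 * Real.pi * κ)).ofReal_comp).mul_const Complex.I
      simpa [w] using this
    exact this.cexp
  have hi0 : IntervalIntegrable (fun Y : ℝ => Y ^ (-α)) volume 0 1 :=
    intervalIntegral.intervalIntegrable_rpow' (by linarith)
  have hi : IntervalIntegrable (fun Y : ℝ => ((Y ^ (-α) : ℝ) : ℂ) * e Y) volume 0 1 :=
    IntervalIntegrable.mul_continuousOn
      ⟨Integrable.ofReal (𝕜 := ℂ) hi0.1, Integrable.ofReal (𝕜 := ℂ) hi0.2⟩ hec.continuousOn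
  have hsub1 : Set.uIcc 0 d ⊆ Set.uIcc (0 : ℝ) 1 := by
    rw [Set.uIcc_of_le hd0.le, Set.uIcc_of_le zero_le_one]
    exact Set.Icc_subset_Icc_right hd1
  have hsub2 : Set.uIcc d 1 ⊆ Set.uIcc (0 : ℝ) 1 := by
    rw [Set.uIcc_of_le hd1, Set.uIcc_of_le zero_le_one]
    exact Set.Icc_subset_Icc_left hd0.le
  rw [← intervalIntegral.integral_add_adjacent_intervals (hi.mono_set hsub1) (hi.mono_set hsub2)]
  have b1 : ‖∫ Y in (0 : ℝ)..d, ((Y ^ (-α) : ℝ) : ℂ) * e Y‖ ≤ 2 * d ^ (1 / 2 : ℝ) := by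
    have := norm_intervalIntegral_rpow_mul_le (p := -(1 / 2)) hd0.le (by norm_num)
      (c := fun Y => ((Y ^ (-α) : ℝ) : ℂ)) (fun Y hY => ?_) hne
    · norm_num at this ⊢
      linarith
    · rw [Complex.norm_real, Real.norm_of_nonneg (Real.rpow_nonneg hY.1.le _)]
      exact Real.rpow_le_rpow_of_exponent_ge hY.1 (hY.2.trans hd1) (by linarith)
  have hY0 : ∀ Y ∈ Set.uIcc d 1, 0 < Y := fun Y hY => by
    rw [Set.uIcc_of_le hd1] at hY
    exact hd0.trans_le hY.1
  have hder : ∀ Y ∈ Set.uIcc d 1, HasDerivAt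
      (fun Y : ℝ => w⁻¹ * (((Y ^ (-α) : ℝ) : ℂ) * e Y))
      (w⁻¹ * (((-α * Y ^ (-α - 1) : ℝ) : ℂ) * e Y) + ((Y ^ (-α) : ℝ) : ℂ) * e Y) Y := by
    intro Y hY
    have := (((Real.hasDerivAt_rpow_const (p := -α) (Or.inl (hY0 Y hY).ne')).ofReal_comp).mul
      (hee Y)).const_mul w⁻¹
    refine this.congr_deriv ?_
    field_simp
  have hcont : ∀ p : ℝ, ContinuousOn (fun Y : ℝ => Y ^ p) (Set.uIcc d 1) := fun p =>
    continuousOn_id.rpow_const fun Y hY => Or.inl (hY0 Y hY).ne'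
  have hI1 : IntervalIntegrable (fun Y : ℝ => ((-α * Y ^ (-α - 1) : ℝ) : ℂ) * e Y)
      volume d 1 :=
    ((Complex.continuous_ofReal.comp_continuousOn ((hcont (-α - 1)).const_mul (-α))).mul
      hec.continuousOn).intervalIntegrable
  have hI2 := hi.mono_set hsub2
  have hint := intervalIntegral.integral_eq_sub_of_hasDerivAt hder
    ((hI1.const_mul w⁻¹).add hI2)
  rw [intervalIntegral.integral_add (hI1.const_mul w⁻¹) hI2,
    intervalIntegral.integral_const_mul] at hint
  have b3 : ‖∫ Y in d..1, ((-α * Y ^ (-α - 1) : ℝ) : ℂ) * e Y‖ ≤ d ^ (-α) - 1 := by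
    have hr : ∫ Y in d..1, α * Y ^ (-α - 1) = d ^ (-α) - 1 := by
      have : ∀ Y ∈ Set.uIcc d 1, HasDerivAt (fun Y : ℝ => -Y ^ (-α)) (α * Y ^ (-α - 1)) Y := by
        intro Y hY
        refine (Real.hasDerivAt_rpow_const (p := -α) (Or.inl (hY0 Y hY).ne')).neg.congr_deriv ?_
        ring
      rw [intervalIntegral.integral_eq_sub_of_hasDerivAt this
        ((hcont (-α - 1)).const_mul α).intervalIntegrable, Real.one_rpow]
      ring
    rw [← hr]
    refine intervalIntegral.norm_integral_le_of_norm_le hd1 (ae_of_all _ fun Y hY => ?_)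
      ((hcont (-α - 1)).const_mul α).intervalIntegrable
    have hYp : 0 < Y := hd0.trans hY.1
    rw [norm_mul, hne, mul_one, Complex.norm_real, norm_mul, norm_neg, Real.norm_of_nonneg h0,
      Real.norm_of_nonneg (Real.rpow_nonneg hYp.le _)]
  have hdα : d ^ (-α) ≤ d ^ (-(1 / 2) : ℝ) :=
    Real.rpow_le_rpow_of_exponent_ge hd0 hd1 (by linarith)
  have b2 : ‖∫ Y in d..1, ((Y ^ (-α) : ℝ) : ℂ) * e Y‖ ≤ d ^ (1 / 2 : ℝ) := by
    have h4 : ∫ Y in d..1, ((Y ^ (-α) : ℝ) : ℂ) * e Y =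
        w⁻¹ * ((((1 : ℝ) ^ (-α) : ℝ) : ℂ) * e 1 - ((d ^ (-α) : ℝ) : ℂ) * e d -
          ∫ Y in d..1, ((-α * Y ^ (-α - 1) : ℝ) : ℂ) * e Y) := by
      linear_combination hint
    rw [h4, norm_mul, hwn]
    have h5 : ‖(((1 : ℝ) ^ (-α) : ℝ) : ℂ) * e 1‖ = 1 := by
      rw [norm_mul, hne, Real.one_rpow]
      simp
    have h6 : ‖((d ^ (-α) : ℝ) : ℂ) * e d‖ = d ^ (-α) := by
      rw [norm_mul, hne, mul_one, Complex.norm_real,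
        Real.norm_of_nonneg (Real.rpow_nonneg hd0.le _)]
    have h7 : d * d ^ (-(1 / 2) : ℝ) = d ^ (1 / 2 : ℝ) := by
      nth_rewrite 1 [← Real.rpow_one d]
      rw [← Real.rpow_add hd0]
      norm_num
    calc _ ≤ d / (2 * Real.pi) * (1 + d ^ (-α) + (d ^ (-α) - 1)) := by
          gcongr
          refine (norm_sub_le _ _).trans (add_le_add ((norm_sub_le _ _).trans ?_) b3)
          rw [h5, h6]
      _ = d * d ^ (-α) / Real.pi := by field_simp; ring
      _ ≤ d * d ^ (-(1 / 2) : ℝ) / 1 := by gcongr; linarith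
      _ = _ := by rw [h7, div_one]
  exact (norm_add_le _ _).trans (by linarith)

/-- Quadratic decay of the coefficients makes the Fourier series converge at every point, as needed
to evaluate $\widehat\phi$ at each frequency. -/
theorem summable_fourierCoeff_circleProfile {n : ℕ} [Fact (0 < (n : ℝ))] {L Y : ℝ} (hL : 0 ≤ L)
    (hY : Y ∈ Set.Ioo (0 : ℝ) 1) : Summable (fourierCoeff (circleProfile n L Y)) := by
  have hn : (1 : ℝ) ≤ n := by
    have : 1 ≤ n := by exact_mod_cast (Fact.out : 0 < (n : ℝ))
    exact_mod_cast this
  refine Summable.of_norm_bounded ((summable_one_add_abs_int_rpow one_lt_two).mul_left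
    (20 * Real.exp (L / 2) * (2 * n) ^ 2)) fun l => ?_
  rw [fourierCoeff_circleProfile, norm_mul, norm_inv, Complex.norm_natCast]
  have h1 := norm_profileTransform_le_div_sq hL ((Y + l) / n)
  have h2 : 1 + |(l : ℝ)| ≤ 2 * n * (1 + |(Y + l) / n|) := by
    have e : (n : ℝ) * |(Y + l) / n| = |Y + l| := by
      rw [abs_div, Nat.abs_cast, mul_div_cancel₀ _ (by positivity)]
    have : |(l : ℝ)| ≤ 1 + |Y + l| := by
      rw [abs_le]
      constructor <;> linarith [hY.1, hY.2, neg_abs_le (Y + l), le_abs_self (Y + l)]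
    nlinarith [abs_nonneg (Y + l)]
  have h3 : ((1 + |(Y + l) / n|) ^ 2)⁻¹ ≤ (2 * n) ^ 2 * (1 + |(l : ℝ)|) ^ (-2 : ℝ) := by
    rw [Real.rpow_neg (by positivity), Real.rpow_two, ← div_eq_mul_inv,
      le_div_iff₀ (by positivity), inv_mul_le_iff₀ (by positivity), ← mul_pow]
    gcongr
    linarith
  calc _ ≤ 1 * ‖profileTransform L ((Y + l) / n)‖ := by
        gcongr
        exact inv_le_one_of_one_le₀ hn
    _ ≤ 20 * (Real.exp (L / 2) * ((2 * n) ^ 2 * (1 + |(l : ℝ)|) ^ (-2 : ℝ))) := by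
        rw [one_mul]
        exact h1.trans (by gcongr)
    _ = _ := by ring

/-- For fixed $Y$ the sum over the coset is the Fourier series of the modulated profile at $\theta$
modulo $n$. The phases $e^{2\pi iY(\theta+nk)/n}$ and $e^{-2\pi iY\theta/n}$ combine to $e^{2\pi
ikY}$. -/
theorem fourier_generator_eq {n : ℕ} (hn : 1 ≤ n) {θ : ℝ} (hθ : θ ∈ Set.Ico (0 : ℝ) n) (k : ℤ) :
    𝓕 (generator n) (-(θ + n * k)) = if θ ≤ 1 then
      ∫ Y in (0 : ℝ)..1, (profile (-Real.log Y) θ : ℂ) *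
        Complex.exp ((2 * Real.pi * k * Y : ℝ) * Complex.I) else 0 := by
  have hn0 : (0 : ℝ) < n := by exact_mod_cast hn
  have hnC : (n : ℂ) ≠ 0 := by exact_mod_cast hn0.ne'
  have : Fact (0 < (n : ℝ)) := ⟨hn0⟩
  set ξ : ℝ := -(θ + n * k)
  have hint : Integrable fun x : ℝ =>
      Complex.exp ((-2 * Real.pi * x * ξ : ℝ) * Complex.I) * generator n x := by
    refine (integrable_generator hn).bdd_mul (c := 1) (by fun_prop) (ae_of_all _ fun x => ?_)
    rw [Complex.norm_exp_ofReal_mul_I]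
  have hθk : (((-ξ : ℝ)) : AddCircle (n : ℝ)) = (θ : AddCircle (n : ℝ)) := by
    simp only [ξ, neg_neg]
    rw [mul_comm, ← zsmul_eq_mul]
    rw [AddCircle.coe_add, AddCircle.coe_zsmul, AddCircle.coe_period, smul_zero, add_zero]
  have hS : ∀ Y ∈ Set.Ioo (0 : ℝ) 1, HasSum (fun l : ℤ =>
      Complex.exp ((-2 * Real.pi * ((Y + l) / n) * ξ : ℝ) * Complex.I) *
        generator n ((Y + l) / n))
      (n * (if θ ≤ 1 then (profile (-Real.log Y) θ : ℂ) *
        Complex.exp ((2 * Real.pi * k * Y : ℝ) * Complex.I) else 0)) := by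
    intro Y hY
    have hL : 0 ≤ -Real.log Y := neg_nonneg.2 (Real.log_nonpos hY.1.le hY.2.le)
    have h := has_pointwise_sum_fourier_series_of_summable
      (summable_fourierCoeff_circleProfile (n := n) hL hY) ((-ξ : ℝ) : AddCircle (n : ℝ))
    rw [hθk, circleProfile_coe _ _ hθ, ← hθk] at h
    have h' := h.mul_left (n * Complex.exp ((-2 * Real.pi * (Y / n) * ξ : ℝ) * Complex.I))
    have e1 : ∀ l : ℤ, Complex.exp ((-2 * Real.pi * ((Y + l) / n) * ξ : ℝ) * Complex.I) *
        generator n ((Y + l) / n) =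
        n * Complex.exp ((-2 * Real.pi * (Y / n) * ξ : ℝ) * Complex.I) *
          (fourierCoeff (circleProfile n (-Real.log Y) Y) l •
            fourier l ((-ξ : ℝ) : AddCircle (n : ℝ))) := by
      intro l
      rw [generator_add_int_div hn hY, fourierCoeff_circleProfile, fourier_coe_apply, smul_eq_mul]
      have : Complex.exp ((-2 * Real.pi * ((Y + l) / n) * ξ : ℝ) * Complex.I) =
          Complex.exp ((-2 * Real.pi * (Y / n) * ξ : ℝ) * Complex.I) *
            Complex.exp (2 * Real.pi * Complex.I * l * (-ξ : ℝ) / (n : ℝ)) := by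
        rw [← Complex.exp_add]
        congr 1
        push_cast
        field_simp
        ring
      rw [this]
      field_simp
    rw [funext e1]
    refine Eq.subst (motive := fun z => HasSum _ z) ?_ h'
    rw [mul_assoc]
    congr 1
    split_ifs
    · rw [mul_left_comm, ← Complex.exp_add]
      congr 2
      simp only [ξ]
      push_cast
      field_simp
      ring
    · simp
  rw [Real.fourier_real_eq_integral_exp_smul]
  simp only [smul_eq_mul]
  rw [integral_eq_integral_of_hasSum_comp_add_int hint hn hS,
    intervalIntegral.integral_const_mul, inv_mul_cancel_left₀ hnC]
  split_ifs <;> simp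

theorem profile_neg_log {t Y : ℝ} (hY : 0 < Y) :
    profile (-Real.log Y) t =
      Real.sin (Real.pi * t) * Y ^ (-(Real.cos (Real.pi * t) ^ 2 / 2)) := by
  rw [profile, Real.rpow_def_of_pos hY]
  ring_nf

theorem norm_fourier_generator_le {n : ℕ} (hn : 1 ≤ n) (ξ : ℝ) :
    ‖𝓕 (generator n) ξ‖ * |ξ| ^ (1 / 2 : ℝ) ≤ 3 * (2 * n : ℝ) ^ (1 / 2 : ℝ) := by
  have hn1 : (1 : ℝ) ≤ n := by exact_mod_cast hn
  have hn0 : (0 : ℝ) < n := by linarith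
  obtain ⟨θ, k, hθ, rfl⟩ : ∃ θ : ℝ, ∃ k : ℤ, θ ∈ Set.Ico (0 : ℝ) n ∧ ξ = -(θ + n * k) := by
    refine ⟨-ξ - n * ⌊-ξ / n⌋, ⌊-ξ / n⌋, ⟨?_, ?_⟩, by ring⟩
    · have := Int.floor_le (-ξ / n)
      rw [le_div_iff₀ hn0] at this
      linarith
    · have := Int.lt_floor_add_one (-ξ / n)
      rw [div_lt_iff₀ hn0] at this
      linarith
  rw [fourier_generator_eq hn hθ]
  split_ifs with h1
  swap
  · simp only [norm_zero, zero_mul]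
    positivity
  set α := Real.cos (Real.pi * θ) ^ 2 / 2
  have hα0 : 0 ≤ α := by positivity
  have hα1 : α ≤ 1 / 2 := by
    have := Real.cos_sq_le_one (Real.pi * θ)
    simp only [α]; linarith
  set e : ℝ → ℂ := fun Y => Complex.exp ((2 * Real.pi * k * Y : ℝ) * Complex.I)
  have hne : ∀ Y, ‖e Y‖ = 1 := fun Y => Complex.norm_exp_ofReal_mul_I _
  have hI : ‖∫ Y in (0 : ℝ)..1, (profile (-Real.log Y) θ : ℂ) * e Y‖ ≤
      ‖∫ Y in (0 : ℝ)..1, ((Y ^ (-α) : ℝ) : ℂ) * e Y‖ := by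
    have : ∫ Y in (0 : ℝ)..1, (profile (-Real.log Y) θ : ℂ) * e Y =
        (Real.sin (Real.pi * θ) : ℂ) * ∫ Y in (0 : ℝ)..1, ((Y ^ (-α) : ℝ) : ℂ) * e Y := by
      rw [← intervalIntegral.integral_const_mul]
      refine intervalIntegral.integral_congr_Ioo_of_le zero_le_one fun Y hY => ?_
      rw [profile_neg_log hY.1, Complex.ofReal_mul, mul_assoc]
    rw [this, norm_mul, Complex.norm_real]
    exact mul_le_of_le_one_left (norm_nonneg _) (Real.abs_sin_le_one _)
  refine (mul_le_mul_of_nonneg_right hI (by positivity)).trans ?_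
  -- For $k=0$ there is no oscillation, but $|\xi|=\theta\le1$ and the integral is at most $2$.
  -- Otherwise $|\xi|\le2n|k|$ balances the $|k|^{-1/2}$ decay.
  by_cases hk : k = 0
  · have b1 := norm_intervalIntegral_rpow_mul_le (p := -(1 / 2)) zero_le_one (by norm_num)
      (c := fun Y => ((Y ^ (-α) : ℝ) : ℂ)) (fun Y hY => by
        rw [Complex.norm_real, Real.norm_of_nonneg (Real.rpow_nonneg hY.1.le _)]
        exact Real.rpow_le_rpow_of_exponent_ge hY.1 hY.2 (by linarith)) hne
    have b2 : |(-(θ + n * (k : ℝ)))| ≤ 2 * n := by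
      rw [hk, Int.cast_zero, mul_zero, add_zero, abs_neg, abs_of_nonneg hθ.1]
      linarith
    norm_num at b1 b2
    refine mul_le_mul (b1.trans (by norm_num)) ?_ (by positivity) (by norm_num)
    exact Real.rpow_le_rpow (abs_nonneg _) (by simpa using b2) (by norm_num)
  · have hk1 : 1 ≤ |(k : ℝ)| := by exact_mod_cast Int.one_le_abs hk
    have b1 := norm_integral_rpow_mul_exp_le hα0 hα1 hk1
    have b2 : |(-(θ + n * (k : ℝ)))| ≤ 2 * n * |(k : ℝ)| := by
      rw [abs_neg]
      refine (abs_add_le _ _).trans ?_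
      rw [abs_of_nonneg hθ.1, abs_mul, Nat.abs_cast]
      nlinarith
    have hk0 : 0 < |(k : ℝ)| := by linarith
    calc _ ≤ 3 * (1 / |(k : ℝ)|) ^ (1 / 2 : ℝ) * (2 * n * |(k : ℝ)|) ^ (1 / 2 : ℝ) := by
          refine mul_le_mul b1 ?_ (by positivity) (by positivity)
          exact Real.rpow_le_rpow (abs_nonneg _) b2 (by norm_num)
      _ = _ := by
          rw [mul_assoc, ← Real.mul_rpow (by positivity) (by positivity)]
          congr 2
          field_simp

end

theorem mainTheorem4 (n : ℕ) (hn : 2 ≤ n) :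
    ∃ (φ : ℝ → ℂ) (_ : MemLp φ 1 (volume : Measure ℝ)) (h2 : MemLp φ 2 (volume : Measure ℝ)),
      Continuous (𝓕 φ) ∧
      IsOrthonormalGenerator (h2.toLp φ) ∧
      IsFracInvariant n (V2 (h2.toLp φ)) ∧
      (∀ ε : ℝ, 0 < ε →
        Integrable (fun x : ℝ => ‖φ x‖ ^ 2 * (1 + |x|) ^ (1 - ε)) (volume : Measure ℝ)) ∧
      BddAbove (Set.range fun ξ : ℝ => ‖𝓕 φ ξ‖ * |ξ| ^ (1 / 2 : ℝ)) := by
  have hn1 : 1 ≤ n := by omega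
  have h2 := memLp_two_generator hn1
  refine ⟨generator n, memLp_one_generator hn1, h2, ?_, isOrthonormalGenerator_generator hn1 h2,
    isFracInvariant_generator hn1 h2, fun ε hε => integrable_norm_sq_generator_mul hn1 hε, ?_⟩
  · exact VectorFourier.fourierIntegral_continuous Real.continuous_fourierChar
      (innerSL ℝ).continuous₂ (integrable_generator hn1)
  · refine ⟨3 * (2 * n : ℝ) ^ (1 / 2 : ℝ), ?_⟩
    rintro _ ⟨ξ, rfl⟩
    exact norm_fourier_generator_le hn1 ξ
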